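/- Let $\alpha,\beta,\gamma,\delta>0$ be the bar lengths of a planar 4-bar linkage (each is smaller than the sum of the other three), let $\sigma=\frac{\alpha+\beta+\gamma+\delta}{2}$, and let the linkage be of elliptic type: $\sigma\ne\alpha+\gamma$, $\sigma\neq\alpha+\beta$, $\sigma\ne\alpha+\delta$. For real $a<0$ put $\sqrt a=i\sqrt{-a}$. Let $$M=\frac{\alpha\beta\gamma\delta}{(\sigma-\alpha)(\sigma-\beta)(\sigma-\gamma)(\sigma-\delta)},\qquad p_x=\sqrt{\tfrac{\alpha\beta}{(\sigma-\alpha)(\sigma-\beta)}-1},\quad p_y=\sqrt{\tfrac{\beta\gamma}{(\sigma-\beta)(\sigma-\gamma)}-1},\quad p_z=\sqrt{\tfrac{\gamma\delta}{(\sigma-\gamma)(\sigma-\delta)}-1},\quad p_w=\sqrt{\tfrac{\delta\alpha}{(\sigma-\delta)(\sigma-\alpha)}-1}.$$ The relation between the half-angle tangents $x,z$ of opposite rotational angles is $g(x,z)=0$ with $$g=(\sigma-\alpha-\gamma)(\sigma-\beta-\gamma)x^2z^2+(\sigma-\alpha)(\sigma-\beta)x^2-(\sigma-\gamma)(\sigma-\delta)z^2+\sigma(\sigma-\alpha-\beta),$$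 in normalized form $$(O)\quad (M-1)\frac{x^2z^2}{p_x^2p_z^2}+\frac{x^2}{p_x^2}+\frac{z^2}{p_z^2}-1=0.$$ The relation between the adjacent $x,y$ is $f(\alpha,\beta,\gamma,\delta,x,y)=0$ with $$f=(\sigma-\beta)(\sigma-\beta-\delta)x^2y^2+(\sigma-\alpha)(\sigma-\alpha-\delta)x^2-2\alpha\gamma xy+(\sigma-\gamma)(\sigma-\gamma-\delta)y^2+\sigma(\sigma-\delta),$$ in normalized form $$(A)\quad \Bigl(\tfrac{\alpha\gamma}{(\sigma-\alpha)(\sigma-\gamma)}-1\Bigr)\frac{x^2y^2}{p_x^2p_y^2}+\frac{x^2}{p_x^2}+\frac{y^2}{p_y^2}+\frac{(\sigma-\beta)(\sigma-\delta)}{(\sigma-\alpha)(\sigma-\gamma)-\beta\delta}-\frac{2\alpha\gamma}{\sqrt{(\sigma-\alpha)(\sigma-\gamma)\left((\sigma-\alpha)(\sigma-\gamma)-\beta\delta\right)}}\,\frac{xy}{p_xp_y}=0;$$ the relation between the adjacent $x,w$ is $f(\beta,\alpha,\delta,\gamma,x,w)=0$, in normalized form $(A_2)$, which is $(A)$ with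 $\alpha\leftrightarrow\beta$, $\gamma\leftrightarrow\delta$ and $(y,p_y)$ replaced by $(w,p_w)$. Put $\varepsilon=1$ if $\alpha+\beta>\sigma$ (that is, $p_x>0$) and $\varepsilon=-1$ if $\alpha+\beta<\sigma$. Let $\mathrm{sn},\mathrm{cn},\mathrm{dn}$ be the Jacobi elliptic functions of modulus $k$ on $\mathbb C$, $K=K(k)$ the quarter period, $K'=K(\sqrt{1-k^2})$. All identities hold at all complex arguments that are not poles; "parametrized" means that the finite complex solutions are exactly the points obtained from those $t\in\mathbb C$ at which the functions involved have no pole. Then $M>0$, $M\neq1$, and: [1] If $M>1$ and $k=\sqrt{1-1/M}$, then $\frac{k^2}{1-k^2}\mathrm{cn}^2t\,\mathrm{cn}^2(t+K)+\mathrm{cn}^2t+\mathrm{cn}^2(t+K)-1=0$, and both $(O)$ and $g=0$ are parametrized by $x=p_x\,\mathrm{cn}\,t$, $z=p_z\,\mathrm{cn}(t+K)$. [2] If $M<1$ and $k=\sqrt{1-M}$, then $-k^2\mathrm{sn}^2t\,\mathrm{sn}^2(t+K)+\mathrm{sn}^2t+\mathrm{sn}^2(t+K)-1=0$, and both $(O)$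 and $g=0$ are parametrized by $x=p_x\,\mathrm{sn}\,t$, $z=p_z\,\mathrm{sn}(t+K)$. [3] If $M>1$ and $k=\sqrt{1-1/M}$, then for all $t,\theta$ with $\mathrm{dn}\,\theta\ne0$ $$\tfrac{k^2\mathrm{sn}^2\theta}{\mathrm{dn}^2\theta}\mathrm{cn}^2t\,\mathrm{cn}^2(t-\theta)+\mathrm{cn}^2t-\tfrac{2\mathrm{cn}\,\theta}{\mathrm{dn}^2\theta}\mathrm{cn}\,t\,\mathrm{cn}(t-\theta)+\mathrm{cn}^2(t-\theta)+\tfrac{(k^2-1)\mathrm{sn}^2\theta}{\mathrm{dn}^2\theta}=0.$$ If $\alpha+\gamma<\sigma$, there is exactly one $\theta_1\in(0,iK')$ with $\mathrm{dn}\,\theta_1=\sqrt{\frac{(\sigma-\alpha)(\sigma-\gamma)}{\alpha\gamma}}$; for $\theta_1\in(0,iK')$ this equation is equivalent to the system $$\tfrac{k^2\mathrm{sn}^2\theta_1}{\mathrm{dn}^2\theta_1}=\tfrac{\alpha\gamma}{(\sigma-\alpha)(\sigma-\gamma)}-1,\quad \tfrac{\mathrm{cn}\,\theta_1}{\mathrm{dn}^2\theta_1}=\tfrac{\alpha\gamma}{\sqrt{(\sigma-\alpha)(\sigma-\gamma)((\sigma-\alpha)(\sigma-\gamma)-\beta\delta)}},\quad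 \tfrac{(k^2-1)\mathrm{sn}^2\theta_1}{\mathrm{dn}^2\theta_1}=\tfrac{(\sigma-\beta)(\sigma-\delta)}{(\sigma-\alpha)(\sigma-\gamma)-\beta\delta},$$ and then $(A)$ is parametrized by $x=p_x\,\mathrm{cn}\,t$, $y=p_y\,\mathrm{cn}(t-\theta_1)$, and $f(\alpha,\beta,\gamma,\delta,x,y)=0$ by $x=p_x\,\mathrm{cn}\,t$, $y=\varepsilon p_y\,\mathrm{cn}(t-\theta_1)$. If $\alpha+\gamma>\sigma$, the same holds after $(\alpha,\beta,\gamma,\delta,x,y,z,w)\to(\delta,\alpha,\beta,\gamma,w,x,y,z)$: now $\mathrm{dn}\,\theta_1=\sqrt{\frac{(\sigma-\beta)(\sigma-\delta)}{\beta\delta}}$, equivalently the transformed system holds, $(A_2)$ is parametrized by $w=p_w\,\mathrm{cn}\,t$, $x=p_x\,\mathrm{cn}(t-\theta_1)$, and $f(\beta,\alpha,\delta,\gamma,x,w)=0$ by $w=p_w\,\mathrm{cn}\,t$, $x=\varepsilon p_x\,\mathrm{cn}(t-\theta_1)$. [4] If $M<1$ and $k=\sqrt{1-M}$, then for all $t,\theta$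 $$-k^2\mathrm{sn}^2\theta\,\mathrm{sn}^2t\,\mathrm{sn}^2(t-\theta)+\mathrm{sn}^2t-2\,\mathrm{cn}\,\theta\,\mathrm{dn}\,\theta\,\mathrm{sn}\,t\,\mathrm{sn}(t-\theta)+\mathrm{sn}^2(t-\theta)-\mathrm{sn}^2\theta=0.$$ If $\alpha+\gamma>\sigma$, there is exactly one $\theta_1\in(0,iK')$ with $\mathrm{dn}\,\theta_1=\sqrt{\frac{\alpha\gamma}{(\sigma-\alpha)(\sigma-\gamma)}}$; for $\theta_1\in(0,iK')$ this equation is equivalent to the system $$-k^2\mathrm{sn}^2\theta_1=\tfrac{\alpha\gamma}{(\sigma-\alpha)(\sigma-\gamma)}-1,\quad \mathrm{cn}\,\theta_1\,\mathrm{dn}\,\theta_1=\tfrac{\alpha\gamma}{\sqrt{(\sigma-\alpha)(\sigma-\gamma)((\sigma-\alpha)(\sigma-\gamma)-\beta\delta)}},\quad -\mathrm{sn}^2\theta_1=\tfrac{(\sigma-\beta)(\sigma-\delta)}{(\sigma-\alpha)(\sigma-\gamma)-\beta\delta},$$ and then $(A)$ is parametrized by $x=p_x\,\mathrm{sn}\,t$,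 $y=p_y\,\mathrm{sn}(t-\theta_1)$, and $f(\alpha,\beta,\gamma,\delta,x,y)=0$ by $x=p_x\,\mathrm{sn}\,t$, $y=\varepsilon p_y\,\mathrm{sn}(t-\theta_1)$. If $\alpha+\gamma<\sigma$, the same holds after the same transformation: now $\mathrm{dn}\,\theta_1=\sqrt{\frac{\beta\delta}{(\sigma-\beta)(\sigma-\delta)}}$, equivalently the transformed system holds, $(A_2)$ is parametrized by $w=p_w\,\mathrm{sn}\,t$, $x=p_x\,\mathrm{sn}(t-\theta_1)$, and $f(\beta,\alpha,\delta,\gamma,x,w)=0$ by $w=p_w\,\mathrm{sn}\,t$, $x=\varepsilon p_x\,\mathrm{sn}(t-\theta_1)$. -/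

import Mathlib

open Set

namespace FourBar

noncomputable section

/-! ### Jacobi elliptic functions of real modulus `k ∈ (0, 1)` -/

/-- The incomplete elliptic integral of the first kind `∫₀^y dψ / √(1 - k² sin² ψ)`. -/
def ellipticF (k y : ℝ) : ℝ :=
  ∫ ψ in (0 : ℝ)..y, 1 / Real.sqrt (1 - k ^ 2 * Real.sin ψ ^ 2)

/-- The quarter period `K(k)`. -/
def quarterPeriod (k : ℝ) : ℝ := ellipticF k (Real.pi / 2)

/-- The complementary modulus `k' = √(1 - k²)`. -/
def coModulus (k : ℝ) : ℝ := Real.sqrt (1 - k ^ 2)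

/-- The Jacobi amplitude: the inverse function of `y ↦ ellipticF k y`, which is an increasing
bijection of `ℝ` for `k ∈ (0, 1)`. -/
def am (k x : ℝ) : ℝ := Function.invFun (ellipticF k) x

/-- `sn` on the real line. -/
def snR (k x : ℝ) : ℝ := Real.sin (am k x)

/-- `cn` on the real line. -/
def cnR (k x : ℝ) : ℝ := Real.cos (am k x)

/-- `dn` on the real line. -/
def dnR (k x : ℝ) : ℝ := Real.sqrt (1 - k ^ 2 * Real.sin (am k x) ^ 2)

/-- The common denominator `cn²(b; k') + k² sn²(a; k) sn²(b; k')` of the three functions at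
`t = a + i b`. It vanishes exactly at their common poles. -/
def jacobiDen (k : ℝ) (t : ℂ) : ℝ :=
  cnR (coModulus k) t.im ^ 2 + k ^ 2 * snR k t.re ^ 2 * snR (coModulus k) t.im ^ 2

/-- `t` is not a pole of `sn`, `cn`, `dn`. -/
def Regular (k : ℝ) (t : ℂ) : Prop := jacobiDen k t ≠ 0

/-- `sn (a + i b; k)`: the addition formula for `sn`, in which `sn (i b; k)`, `cn (i b; k)`,
`dn (i b; k)` are `i sn (b; k') / cn (b; k')`, `1 / cn (b; k')`, `dn (b; k') / cn (b; k')`;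
numerator and denominator have been multiplied by `cn² (b; k')`. -/
def sn (k : ℝ) (t : ℂ) : ℂ :=
  (snR k t.re * dnR (coModulus k) t.im
    + Complex.I * (cnR k t.re * dnR k t.re
        * snR (coModulus k) t.im * cnR (coModulus k) t.im)) / jacobiDen k t

/-- `cn (a + i b; k)`, obtained in the same way. -/
def cn (k : ℝ) (t : ℂ) : ℂ :=
  (cnR k t.re * cnR (coModulus k) t.im
    - Complex.I * (snR k t.re * dnR k t.re
        * snR (coModulus k) t.im * dnR (coModulus k) t.im)) / jacobiDen k t

/-- `dn (a + i b; k)`, obtained in the same way. -/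
def dn (k : ℝ) (t : ℂ) : ℂ :=
  (dnR k t.re * cnR (coModulus k) t.im * dnR (coModulus k) t.im
    - Complex.I * (k ^ 2 * snR k t.re * cnR k t.re * snR (coModulus k) t.im)) / jacobiDen k t

/-! ### The planar 4-bar linkage -/

/-- The square root of a real number, with `√a = i √(-a)` for `a < 0`. -/
def csqrt (a : ℝ) : ℂ :=
  if 0 ≤ a then (Real.sqrt a : ℂ) else Complex.I * (Real.sqrt (-a) : ℂ)

/-- The semi-perimeter `σ`. -/
def semiperimeter (α β γ δ : ℝ) : ℝ := (α + β + γ + δ) / 2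

/-- Bar lengths of a planar 4-bar linkage. -/
structure IsLinkage (α β γ δ : ℝ) : Prop where
  pos_α : 0 < α
  pos_β : 0 < β
  pos_γ : 0 < γ
  pos_δ : 0 < δ
  lt_α : α < β + γ + δ
  lt_β : β < γ + δ + α
  lt_γ : γ < δ + α + β
  lt_δ : δ < α + β + γ

/-- Coefficient of `x² y²`. -/
def f22 (α β γ δ : ℝ) : ℝ :=
  (semiperimeter α β γ δ - β) * (semiperimeter α β γ δ - β - δ)

/-- Coefficient of `x²`. -/
def f20 (α β γ δ : ℝ) : ℝ :=
  (semiperimeter α β γ δ - α) * (semiperimeter α β γ δ - α - δ)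

/-- Half the coefficient of `x y`. -/
def f11 (α γ : ℝ) : ℝ := -(α * γ)

/-- Coefficient of `y²`. -/
def f02 (α β γ δ : ℝ) : ℝ :=
  (semiperimeter α β γ δ - γ) * (semiperimeter α β γ δ - γ - δ)

/-- Constant coefficient. -/
def f00 (α β γ δ : ℝ) : ℝ :=
  semiperimeter α β γ δ * (semiperimeter α β γ δ - δ)

/-- The polynomial `f(α, β, γ, δ, x, y)` whose vanishing is the relation between the half-angle
tangents `x`, `y` of adjacent rotational angles. The relation between `x` and `w` is
`f(β, α, δ, γ, x, w) = 0`. -/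
def f (α β γ δ : ℝ) (x y : ℂ) : ℂ :=
  f22 α β γ δ * x ^ 2 * y ^ 2 + f20 α β γ δ * x ^ 2 + 2 * f11 α γ * x * y
    + f02 α β γ δ * y ^ 2 + f00 α β γ δ

/-- The polynomial `g(α, β, γ, δ, x, z)` whose vanishing is the relation between the half-angle
tangents `x`, `z` of opposite rotational angles. -/
def g (α β γ δ : ℝ) (x z : ℂ) : ℂ :=
  let σ := semiperimeter α β γ δ
  ((σ - α - γ) * (σ - β - γ) : ℝ) * x ^ 2 * z ^ 2 + ((σ - α) * (σ - β) : ℝ) * x ^ 2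
    + (-((σ - γ) * (σ - δ)) : ℝ) * z ^ 2 + (σ * (σ - α - β) : ℝ)

/-- The linkage is of elliptic type. -/
def IsElliptic (α β γ δ : ℝ) : Prop :=
  f22 α β γ δ ≠ 0 ∧ f20 α β γ δ ≠ 0 ∧ f02 α β γ δ ≠ 0

/-- The number `M`. -/
def linkageM (α β γ δ : ℝ) : ℝ :=
  let σ := semiperimeter α β γ δ
  α * β * γ * δ / ((σ - α) * (σ - β) * (σ - γ) * (σ - δ))

/-- The amplitude belonging to the angle between the bars of lengths `a` and `b`, in a linkage of
semi-perimeter `σ`. -/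
def amplitude (σ a b : ℝ) : ℂ := csqrt (a * b / ((σ - a) * (σ - b)) - 1)

/-- The amplitude `p_x`. -/
def px (α β γ δ : ℝ) : ℂ := amplitude (semiperimeter α β γ δ) α β

/-- The amplitude `p_y`. -/
def py (α β γ δ : ℝ) : ℂ := amplitude (semiperimeter α β γ δ) β γ

/-- The amplitude `p_z`. -/
def pz (α β γ δ : ℝ) : ℂ := amplitude (semiperimeter α β γ δ) γ δ

/-- The amplitude `p_w`. -/
def pw (α β γ δ : ℝ) : ℂ := amplitude (semiperimeter α β γ δ) δ α

/-- The relation between opposite angles, written with the amplitudes. -/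
def OppositeEq (α β γ δ : ℝ) (x z : ℂ) : Prop :=
  (linkageM α β γ δ - 1 : ℂ) * (x ^ 2 * z ^ 2 / (px α β γ δ ^ 2 * pz α β γ δ ^ 2))
    + x ^ 2 / px α β γ δ ^ 2 + z ^ 2 / pz α β γ δ ^ 2 - 1 = 0

/-- The relation between the adjacent angles `x`, `y`, written with the amplitudes. -/
def AdjacentEq (α β γ δ : ℝ) (x y : ℂ) : Prop :=
  let σ := semiperimeter α β γ δ
  ((α * γ / ((σ - α) * (σ - γ)) - 1 : ℝ) : ℂ)
        * (x ^ 2 * y ^ 2 / (px α β γ δ ^ 2 * py α β γ δ ^ 2))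
    + x ^ 2 / px α β γ δ ^ 2 + y ^ 2 / py α β γ δ ^ 2
    + (((σ - β) * (σ - δ) / ((σ - α) * (σ - γ) - β * δ) : ℝ) : ℂ)
    - 2 * α * γ / csqrt ((σ - α) * (σ - γ) * ((σ - α) * (σ - γ) - β * δ))
        * (x * y / (px α β γ δ * py α β γ δ)) = 0

/-- The relation between the adjacent angles `x`, `w`, written with the amplitudes. -/
def AdjacentEq₂ (α β γ δ : ℝ) (x w : ℂ) : Prop :=
  let σ := semiperimeter α β γ δ
  ((β * δ / ((σ - β) * (σ - δ)) - 1 : ℝ) : ℂ)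
        * (x ^ 2 * w ^ 2 / (px α β γ δ ^ 2 * pw α β γ δ ^ 2))
    + x ^ 2 / px α β γ δ ^ 2 + w ^ 2 / pw α β γ δ ^ 2
    + (((σ - α) * (σ - γ) / ((σ - β) * (σ - δ) - α * γ) : ℝ) : ℂ)
    - 2 * β * δ / csqrt ((σ - β) * (σ - δ) * ((σ - β) * (σ - δ) - α * γ))
        * (x * w / (px α β γ δ * pw α β γ δ)) = 0

/-- The plane curve `{(x, y) ∈ ℂ² | R x y}` is parametrized by `t ↦ (φ t, ψ t)`, `t ∈ S`: all these
points lie on the curve, and they are all the points of the curve. -/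
def ParametrizedBy (R : ℂ → ℂ → Prop) (S : Set ℂ) (φ ψ : ℂ → ℂ) : Prop :=
  ∀ x y : ℂ, R x y ↔ ∃ t ∈ S, x = φ t ∧ y = ψ t

/-- The parameters `t` for which neither `t` nor `t + c` is a pole. -/
def regularSet (k : ℝ) (c : ℂ) : Set ℂ := {t | Regular k t ∧ Regular k (t + c)}

end

end FourBar

open FourBar

/-! Dividing each tangent by its amplitude turns every relation, up to a nonzero factor, into a
biquadratic normal form. For opposite angles its only parameter is `M`; for adjacent angles it is
the symmetric form `A₁X²Y² + X² - 2AXY + Y² + A₃ = 0`. By the addition theorems, `sn t` and `sn (t -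
θ)`, and likewise the two values of `cn`, satisfy a biquadratic of the same shape (`sn_biquadratic`,
`cn_biquadratic`); for the shift `K` the mixed term disappears because `cn K = 0`. It remains to
match coefficients. The modulus is determined by `M`, and the adjacent coefficients are functions of
`M` and of the number `r = dn² θ > 1`. On `(0, iK')` both `cn` and `dn` are positive and `dn` takes
each value above `1` once, which fixes `θ` and the sign of the mixed coefficient (`adjacent_cn`,
`adjacent_sn`).

The curve is exhausted for the following reason. The image of `sn` is open by the open mapping
theorem; it is closed because `sn` is doubly periodic and tends to infinity at its poles. So `sn`,
and hence `cn`, takes every value, and `t` can be chosen to match the first coordinate. The second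
coordinate is then a root of a quadratic whose roots are the values at `t - θ` and `t + θ`, and a
reflection of `t` exchanges the two. If the leading coefficient vanishes, at least one of `t ± θ` is
not a pole, and it gives the only root.

The complex functions are explicit quotients in the real and imaginary parts of `t`. They satisfy
the Cauchy-Riemann equations, and their poles form a countable set with connected complement, so
identities extend from real arguments (`jacobi_identity_of_real`). On the real line the addition
theorems follow from a vanishing derivative.

For the linkage, `M - 1` factors through `σ - α - γ`, `σ - α - β`, `σ - β - γ` (`linkageM_sub_one`).
If `(M - 1)(σ - α - γ) > 0`, then `p_x`, `p_y` are both real or both imaginary and the radicand in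
the mixed term is positive; in the remaining cases a cyclic rotation of the lengths restores this.
The sign `ε` compensates `i² = -1` when both amplitudes are imaginary. -/

namespace FourBar

/-! ### The real Jacobi functions -/

section Real

variable {k : ℝ}

lemma one_sub_sq_mul_sq_pos (hk : k ∈ Ioo (0 : ℝ) 1) {s : ℝ} (hs : s ^ 2 ≤ 1) :
    0 < 1 - k ^ 2 * s ^ 2 := by
  have : k ^ 2 < 1 := by nlinarith [hk.1, hk.2]
  nlinarith [sq_nonneg s, sq_nonneg k]

lemma one_sub_sq_mul_sin_sq_pos (hk : k ∈ Ioo (0 : ℝ) 1) (y : ℝ) :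
    0 < 1 - k ^ 2 * Real.sin y ^ 2 :=
  one_sub_sq_mul_sq_pos hk (Real.sin_sq_le_one y)

lemma continuous_ellipticF_integrand (hk : k ∈ Ioo (0 : ℝ) 1) :
    Continuous fun ψ : ℝ => 1 / Real.sqrt (1 - k ^ 2 * Real.sin ψ ^ 2) := by
  refine continuous_const.div (by fun_prop) fun y => ?_
  exact (Real.sqrt_pos.2 (one_sub_sq_mul_sin_sq_pos hk y)).ne'

lemma hasDerivAt_ellipticF (hk : k ∈ Ioo (0 : ℝ) 1) (y : ℝ) :
    HasDerivAt (ellipticF k) (1 / Real.sqrt (1 - k ^ 2 * Real.sin y ^ 2)) y :=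
  ((continuous_ellipticF_integrand hk).integral_hasStrictDerivAt 0 y).hasDerivAt

lemma one_le_ellipticF_integrand (hk : k ∈ Ioo (0 : ℝ) 1) (y : ℝ) :
    1 ≤ 1 / Real.sqrt (1 - k ^ 2 * Real.sin y ^ 2) := by
  rw [one_le_div (Real.sqrt_pos.2 (one_sub_sq_mul_sin_sq_pos hk y)), Real.sqrt_le_one]
  nlinarith [sq_nonneg (k * Real.sin y)]

lemma continuous_ellipticF (hk : k ∈ Ioo (0 : ℝ) 1) : Continuous (ellipticF k) :=
  continuous_iff_continuousAt.2 fun y => (hasDerivAt_ellipticF hk y).continuousAt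

lemma strictMono_ellipticF (hk : k ∈ Ioo (0 : ℝ) 1) : StrictMono (ellipticF k) := by
  refine strictMono_of_deriv_pos fun y => ?_
  rw [(hasDerivAt_ellipticF hk y).deriv]
  exact one_pos.trans_le (one_le_ellipticF_integrand hk y)

@[simp]
lemma ellipticF_zero (k : ℝ) : ellipticF k 0 = 0 := by simp [ellipticF]

/-- The integrand is at least `1`. Together with the value at `0` this gives the linear growth that
makes `ellipticF k` surjective. -/
lemma monotone_ellipticF_sub_id (hk : k ∈ Ioo (0 : ℝ) 1) :
    Monotone fun y => ellipticF k y - y := by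
  refine monotone_of_deriv_nonneg
    (fun y => ((hasDerivAt_ellipticF hk y).sub (hasDerivAt_id y)).differentiableAt) fun y => ?_
  have : deriv (fun y => ellipticF k y - y) y = _ :=
    ((hasDerivAt_ellipticF hk y).sub (hasDerivAt_id y)).deriv
  rw [this]
  exact sub_nonneg.2 (one_le_ellipticF_integrand hk y)

lemma surjective_ellipticF (hk : k ∈ Ioo (0 : ℝ) 1) : Function.Surjective (ellipticF k) := by
  have hm := monotone_ellipticF_sub_id hk
  refine (continuous_ellipticF hk).surjective ?_ ?_
  · refine Filter.tendsto_atTop_mono' _ ?_ Filter.tendsto_id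
    filter_upwards [Filter.eventually_ge_atTop 0] with y hy
    simpa using hm hy
  · refine Filter.tendsto_atBot_mono' _ ?_ Filter.tendsto_id
    filter_upwards [Filter.eventually_le_atBot 0] with y hy
    simpa using hm hy

lemma am_ellipticF (hk : k ∈ Ioo (0 : ℝ) 1) (y : ℝ) : am k (ellipticF k y) = y :=
  Function.leftInverse_invFun (strictMono_ellipticF hk).injective y

lemma ellipticF_am (hk : k ∈ Ioo (0 : ℝ) 1) (x : ℝ) : ellipticF k (am k x) = x :=
  Function.rightInverse_invFun (surjective_ellipticF hk) x

lemma strictMono_am (hk : k ∈ Ioo (0 : ℝ) 1) : StrictMono (am k) := fun x y h => by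
  rwa [← (strictMono_ellipticF hk).lt_iff_lt, ellipticF_am hk, ellipticF_am hk]

/-- A monotone surjection of the line has no jumps. -/
lemma continuous_am (hk : k ∈ Ioo (0 : ℝ) 1) : Continuous (am k) :=
  (strictMono_am hk).monotone.continuous_of_surjective fun y => ⟨_, am_ellipticF hk y⟩

lemma hasDerivAt_am (hk : k ∈ Ioo (0 : ℝ) 1) (x : ℝ) : HasDerivAt (am k) (dnR k x) x := by
  have h := (hasDerivAt_ellipticF hk (am k x)).of_local_left_inverse
    (continuous_am hk).continuousAt (one_pos.trans_le (one_le_ellipticF_integrand hk _)).ne'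
    (Filter.Eventually.of_forall (ellipticF_am hk))
  simpa [dnR] using h

lemma snR_sq_add_cnR_sq (k x : ℝ) : snR k x ^ 2 + cnR k x ^ 2 = 1 := Real.sin_sq_add_cos_sq _

lemma snR_sq_le_one (k x : ℝ) : snR k x ^ 2 ≤ 1 := Real.sin_sq_le_one _

lemma dnR_sq (hk : k ∈ Ioo (0 : ℝ) 1) (x : ℝ) : dnR k x ^ 2 = 1 - k ^ 2 * snR k x ^ 2 :=
  Real.sq_sqrt (one_sub_sq_mul_sin_sq_pos hk _).le

lemma dnR_pos (hk : k ∈ Ioo (0 : ℝ) 1) (x : ℝ) : 0 < dnR k x :=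
  Real.sqrt_pos.2 (one_sub_sq_mul_sin_sq_pos hk _)

lemma hasDerivAt_snR (hk : k ∈ Ioo (0 : ℝ) 1) (x : ℝ) :
    HasDerivAt (snR k) (cnR k x * dnR k x) x :=
  (hasDerivAt_am hk x).sin

lemma hasDerivAt_cnR (hk : k ∈ Ioo (0 : ℝ) 1) (x : ℝ) :
    HasDerivAt (cnR k) (-(snR k x * dnR k x)) x :=
  (hasDerivAt_am hk x).cos.congr_deriv (neg_mul _ _)

lemma hasDerivAt_dnR (hk : k ∈ Ioo (0 : ℝ) 1) (x : ℝ) :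
    HasDerivAt (dnR k) (-(k ^ 2 * snR k x * cnR k x)) x := by
  have h := ((((hasDerivAt_snR hk x).pow 2).const_mul (k ^ 2)).const_sub 1).sqrt
    (one_sub_sq_mul_sin_sq_pos hk _).ne'
  refine h.congr_deriv ?_
  have hd := (dnR_pos hk x).ne'
  rw [show Real.sqrt (1 - k ^ 2 * (snR k ^ 2) x) = dnR k x from rfl]
  field_simp
  norm_num
  ring

@[simp]
lemma am_zero (hk : k ∈ Ioo (0 : ℝ) 1) : am k 0 = 0 := by
  simpa using am_ellipticF hk 0

lemma snR_zero (hk : k ∈ Ioo (0 : ℝ) 1) : snR k 0 = 0 := by simp [snR, hk]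

lemma cnR_zero (hk : k ∈ Ioo (0 : ℝ) 1) : cnR k 0 = 1 := by simp [cnR, hk]

lemma dnR_zero (hk : k ∈ Ioo (0 : ℝ) 1) : dnR k 0 = 1 := by simp [dnR, hk]

lemma ellipticF_neg (k y : ℝ) : ellipticF k (-y) = -ellipticF k y := by
  unfold ellipticF
  have := intervalIntegral.integral_comp_neg (a := 0) (b := y)
    (fun ψ => 1 / Real.sqrt (1 - k ^ 2 * Real.sin ψ ^ 2))
  simp only [Real.sin_neg, neg_sq, neg_zero] at this
  rw [intervalIntegral.integral_symm, this]

lemma am_neg (hk : k ∈ Ioo (0 : ℝ) 1) (x : ℝ) : am k (-x) = -am k x := by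
  rw [← am_ellipticF hk (-am k x), ellipticF_neg, ellipticF_am hk]

lemma snR_neg (hk : k ∈ Ioo (0 : ℝ) 1) (x : ℝ) : snR k (-x) = -snR k x := by
  simp [snR, am_neg hk]

lemma cnR_neg (hk : k ∈ Ioo (0 : ℝ) 1) (x : ℝ) : cnR k (-x) = cnR k x := by
  simp [cnR, am_neg hk]

lemma dnR_neg (hk : k ∈ Ioo (0 : ℝ) 1) (x : ℝ) : dnR k (-x) = dnR k x := by
  simp [dnR, am_neg hk]

lemma am_quarterPeriod (hk : k ∈ Ioo (0 : ℝ) 1) : am k (quarterPeriod k) = Real.pi / 2 :=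
  am_ellipticF hk _

lemma quarterPeriod_pos (hk : k ∈ Ioo (0 : ℝ) 1) : 0 < quarterPeriod k := by
  simpa [quarterPeriod] using strictMono_ellipticF hk (half_pos Real.pi_pos)

lemma snR_quarterPeriod (hk : k ∈ Ioo (0 : ℝ) 1) : snR k (quarterPeriod k) = 1 := by
  simp [snR, am_quarterPeriod hk]

lemma cnR_quarterPeriod (hk : k ∈ Ioo (0 : ℝ) 1) : cnR k (quarterPeriod k) = 0 := by
  simp [cnR, am_quarterPeriod hk]

lemma snR_pos (hk : k ∈ Ioo (0 : ℝ) 1) {x : ℝ} (hx : x ∈ Ioo 0 (quarterPeriod k)) :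
    0 < snR k x := by
  have h0 := strictMono_am hk hx.1
  have h1 := strictMono_am hk hx.2
  rw [am_zero hk] at h0
  rw [am_quarterPeriod hk] at h1
  exact Real.sin_pos_of_pos_of_lt_pi h0 (by linarith [Real.pi_pos])

lemma cnR_pos (hk : k ∈ Ioo (0 : ℝ) 1) {x : ℝ} (hx : x ∈ Ioo 0 (quarterPeriod k)) :
    0 < cnR k x := by
  have h0 := strictMono_am hk hx.1
  have h1 := strictMono_am hk hx.2
  rw [am_zero hk] at h0
  rw [am_quarterPeriod hk] at h1
  exact Real.cos_pos_of_mem_Ioo ⟨by linarith [Real.pi_pos], h1⟩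

/-! ### Addition theorems on the real line -/

lemma one_sub_sq_mul_snR_sq_mul_snR_sq_pos (hk : k ∈ Ioo (0 : ℝ) 1) (x y : ℝ) :
    0 < 1 - k ^ 2 * snR k x ^ 2 * snR k y ^ 2 := by
  have h : (snR k x * snR k y) ^ 2 ≤ 1 := by
    rw [mul_pow]
    exact mul_le_one₀ (snR_sq_le_one k x) (sq_nonneg _) (snR_sq_le_one k y)
  have := one_sub_sq_mul_sq_pos hk h
  linarith [mul_pow (snR k x) (snR k y) 2]

lemma hasDerivAt_comp_const_sub {u : ℝ → ℝ} {u' c x : ℝ} (h : HasDerivAt u u' (c - x)) :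
    HasDerivAt (fun x => u (c - x)) (-u') x := by
  have := h.comp x ((hasDerivAt_id x).const_sub c)
  rwa [mul_neg_one] at this

/-- A quotient with nowhere vanishing denominator is constant if the Wronskian of numerator and
denominator vanishes. -/
lemma div_eq_of_wronskian_eq_zero {u v u' v' : ℝ → ℝ} (hu : ∀ x, HasDerivAt u (u' x) x)
    (hv : ∀ x, HasDerivAt v (v' x) x) (hv0 : ∀ x, v x ≠ 0)
    (h : ∀ x, u' x * v x - u x * v' x = 0) (x y : ℝ) : u x / v x = u y / v y := by
  refine is_const_of_deriv_eq_zero (f := fun x => u x / v x)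
    (fun x => ((hu x).div (hv x) (hv0 x)).differentiableAt) (fun x => ?_) x y
  exact ((hu x).div (hv x) (hv0 x)).deriv.trans (by simp [h])

/-- With `c = x + y` held fixed, the quotient that should equal `snR k c` is a function of `x`
alone. Its derivative vanishes, and at `x = 0` its value is `snR k c`. -/
lemma snR_add (hk : k ∈ Ioo (0 : ℝ) 1) (x y : ℝ) :
    snR k (x + y) * (1 - k ^ 2 * snR k x ^ 2 * snR k y ^ 2)
      = snR k x * cnR k y * dnR k y + snR k y * cnR k x * dnR k x := by
  set c := x + y with hc
  have hs := fun x => hasDerivAt_snR hk x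
  have hcn := fun x => hasDerivAt_cnR hk x
  have hd := fun x => hasDerivAt_dnR hk x
  have hs' := fun x => hasDerivAt_comp_const_sub (hs (c - x))
  have hcn' := fun x => hasDerivAt_comp_const_sub (hcn (c - x))
  have hd' := fun x => hasDerivAt_comp_const_sub (hd (c - x))
  have key := div_eq_of_wronskian_eq_zero
    (fun x => (((hs x).mul (hcn' x)).mul (hd' x)).add (((hs' x).mul (hcn x)).mul (hd x)))
    (fun x => ((((hs x).pow 2).const_mul (k ^ 2)).mul ((hs' x).pow 2)).const_sub 1)
    (fun x => (one_sub_sq_mul_snR_sq_mul_snR_sq_pos hk x (c - x)).ne')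
    -- The Wronskian is a polynomial in the six values at `x` and `c - x`; it vanishes modulo the
    -- Pythagorean relations for `cnR` and `dnR`.
    (fun x => by
      have h1 := snR_sq_add_cnR_sq k x
      have h2 := snR_sq_add_cnR_sq k (c - x)
      have h3 := dnR_sq hk x
      have h4 := dnR_sq hk (c - x)
      simp only [Pi.mul_apply, Pi.add_apply, Pi.pow_apply]
      generalize snR k x = s1 at *
      generalize snR k (c - x) = s2 at *
      generalize cnR k x = c1 at *
      generalize cnR k (c - x) = c2 at *
      generalize dnR k x = d1 at *
      generalize dnR k (c - x) = d2 at *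
      have h1 : c1 ^ 2 = 1 - s1 ^ 2 := by linarith
      have h2 : c2 ^ 2 = 1 - s2 ^ 2 := by linarith
      grind) x 0
  have hy : c - x = y := by rw [hc]; ring
  simp only [Pi.mul_apply, Pi.add_apply, Pi.pow_apply, hy, snR_zero hk, cnR_zero hk, dnR_zero hk,
    sub_zero] at key
  rw [div_eq_iff (one_sub_sq_mul_snR_sq_mul_snR_sq_pos hk x y).ne'] at key
  rw [key]
  ring

/-- Same argument as for `snR_add`: the quotient is constant along `x + y = c` and equals `cnR k c`
at `x = 0`. -/
lemma cnR_add (hk : k ∈ Ioo (0 : ℝ) 1) (x y : ℝ) :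
    cnR k (x + y) * (1 - k ^ 2 * snR k x ^ 2 * snR k y ^ 2)
      = cnR k x * cnR k y - snR k x * snR k y * dnR k x * dnR k y := by
  set c := x + y with hc
  have hs := fun x => hasDerivAt_snR hk x
  have hcn := fun x => hasDerivAt_cnR hk x
  have hd := fun x => hasDerivAt_dnR hk x
  have hs' := fun x => hasDerivAt_comp_const_sub (hs (c - x))
  have hcn' := fun x => hasDerivAt_comp_const_sub (hcn (c - x))
  have hd' := fun x => hasDerivAt_comp_const_sub (hd (c - x))
  have key := div_eq_of_wronskian_eq_zero
    (fun x => ((hcn x).mul (hcn' x)).sub ((((hs x).mul (hs' x)).mul (hd x)).mul (hd' x)))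
    (fun x => ((((hs x).pow 2).const_mul (k ^ 2)).mul ((hs' x).pow 2)).const_sub 1)
    (fun x => (one_sub_sq_mul_snR_sq_mul_snR_sq_pos hk x (c - x)).ne')
    (fun x => by
      have h1 := snR_sq_add_cnR_sq k x
      have h2 := snR_sq_add_cnR_sq k (c - x)
      have h3 := dnR_sq hk x
      have h4 := dnR_sq hk (c - x)
      simp only [Pi.mul_apply, Pi.sub_apply, Pi.pow_apply]
      generalize snR k x = s1 at *
      generalize snR k (c - x) = s2 at *
      generalize cnR k x = c1 at *
      generalize cnR k (c - x) = c2 at *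
      generalize dnR k x = d1 at *
      generalize dnR k (c - x) = d2 at *
      have h1 : c1 ^ 2 = 1 - s1 ^ 2 := by linarith
      have h2 : c2 ^ 2 = 1 - s2 ^ 2 := by linarith
      grind) x 0
  have hy : c - x = y := by rw [hc]; ring
  simp only [Pi.mul_apply, Pi.sub_apply, Pi.pow_apply, hy, snR_zero hk, cnR_zero hk, dnR_zero hk,
    sub_zero] at key
  rw [div_eq_iff (one_sub_sq_mul_snR_sq_mul_snR_sq_pos hk x y).ne'] at key
  rw [key]
  ring

/-! ### Half periods -/

/-- The integrand has period `π`, so the increment over a period is constant; oddness evaluates it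
at `y = -π/2`. -/
lemma ellipticF_add_pi (hk : k ∈ Ioo (0 : ℝ) 1) (y : ℝ) :
    ellipticF k (y + Real.pi) = ellipticF k y + 2 * quarterPeriod k := by
  have hconst := is_const_of_deriv_eq_zero (f := fun y => ellipticF k (y + Real.pi) - ellipticF k y)
    (fun y => (((hasDerivAt_ellipticF hk (y + Real.pi)).comp_add_const y Real.pi).sub
      (hasDerivAt_ellipticF hk y)).differentiableAt)
    (fun y => (((hasDerivAt_ellipticF hk (y + Real.pi)).comp_add_const y Real.pi).sub
      (hasDerivAt_ellipticF hk y)).deriv.trans (by simp [Real.sin_add_pi])) y (-(Real.pi / 2))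
  have h : -(Real.pi / 2) + Real.pi = Real.pi / 2 := by ring
  simp only [h, ellipticF_neg] at hconst
  unfold quarterPeriod
  linarith

lemma am_add_two_quarterPeriod (hk : k ∈ Ioo (0 : ℝ) 1) (x : ℝ) :
    am k (x + 2 * quarterPeriod k) = am k x + Real.pi := by
  rw [← am_ellipticF hk (am k x + Real.pi), ellipticF_add_pi hk, ellipticF_am hk]

lemma snR_add_two_quarterPeriod (hk : k ∈ Ioo (0 : ℝ) 1) (x : ℝ) :
    snR k (x + 2 * quarterPeriod k) = -snR k x := by
  simp [snR, am_add_two_quarterPeriod hk, Real.sin_add_pi]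

lemma cnR_add_two_quarterPeriod (hk : k ∈ Ioo (0 : ℝ) 1) (x : ℝ) :
    cnR k (x + 2 * quarterPeriod k) = -cnR k x := by
  simp [cnR, am_add_two_quarterPeriod hk, Real.cos_add_pi]

lemma dnR_add_two_quarterPeriod (hk : k ∈ Ioo (0 : ℝ) 1) (x : ℝ) :
    dnR k (x + 2 * quarterPeriod k) = dnR k x := by
  simp [dnR, am_add_two_quarterPeriod hk, Real.sin_add_pi]

/-! ### Countability of the real zeros, and the complementary modulus. -/

lemma countable_setOf_snR_eq_zero (hk : k ∈ Ioo (0 : ℝ) 1) : {x | snR k x = 0}.Countable := by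
  refine (countable_range fun n : ℤ => ellipticF k (n * Real.pi)).mono fun x hx => ?_
  obtain ⟨n, hn⟩ := Real.sin_eq_zero_iff.1 hx
  exact ⟨n, by simp only [hn, ellipticF_am hk]⟩

lemma countable_setOf_cnR_eq_zero (hk : k ∈ Ioo (0 : ℝ) 1) : {x | cnR k x = 0}.Countable := by
  refine (countable_range fun n : ℤ => ellipticF k ((2 * n + 1) * Real.pi / 2)).mono fun x hx => ?_
  obtain ⟨n, hn⟩ := Real.cos_eq_zero_iff.1 hx
  exact ⟨n, by simp only [← hn, ellipticF_am hk]⟩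

lemma coModulus_mem_Ioo (hk : k ∈ Ioo (0 : ℝ) 1) : coModulus k ∈ Ioo (0 : ℝ) 1 := by
  have h1 : k ^ 2 < 1 := by nlinarith [hk.1, hk.2]
  have h0 : 0 < k ^ 2 := by nlinarith [hk.1]
  refine ⟨Real.sqrt_pos.2 (by linarith), ?_⟩
  rw [coModulus, Real.sqrt_lt' one_pos]
  linarith

lemma coModulus_sq (hk : k ∈ Ioo (0 : ℝ) 1) : coModulus k ^ 2 = 1 - k ^ 2 :=
  Real.sq_sqrt (by nlinarith [hk.1, hk.2])

end Real

/-! ### Holomorphy of the complex Jacobi functions -/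

section Holomorphy

open Complex

lemma hasFDerivAt_ofReal_comp_re {u : ℝ → ℝ} {u' : ℝ} {t : ℂ} (h : HasDerivAt u u' t.re) :
    HasFDerivAt (fun t : ℂ => (u t.re : ℂ)) ((u' : ℂ) • (ofRealCLM.comp reCLM)) t := by
  have h2 := (ofRealCLM.hasFDerivAt (x := u t.re)).comp t
    (h.hasFDerivAt.comp t (reCLM.hasFDerivAt (x := t)))
  refine h2.congr_fderiv ?_
  ext
  simp [mul_comm]

lemma hasFDerivAt_ofReal_comp_im {u : ℝ → ℝ} {u' : ℝ} {t : ℂ} (h : HasDerivAt u u' t.im) :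
    HasFDerivAt (fun t : ℂ => (u t.im : ℂ)) ((u' : ℂ) • (ofRealCLM.comp imCLM)) t := by
  have h2 := (ofRealCLM.hasFDerivAt (x := u t.im)).comp t
    (h.hasFDerivAt.comp t (imCLM.hasFDerivAt (x := t)))
  refine h2.congr_fderiv ?_
  ext
  simp [mul_comm]

/-- The Cauchy-Riemann criterion for a quotient. -/
lemma differentiableAt_div_of_cauchyRiemann {N D : ℂ → ℂ} {N' D' : ℂ →L[ℝ] ℂ} {t : ℂ}
    (hN : HasFDerivAt N N' t) (hD : HasFDerivAt D D' t) (h0 : D t ≠ 0)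
    (h : N' I * D t - N t * D' I = I * (N' 1 * D t - N t * D' 1)) :
    DifferentiableAt ℂ (fun t => N t / D t) t := by
  have hq : HasFDerivAt (fun t => N t / D t)
      (((D t) ^ 2)⁻¹ • (D t • N' - N t • D')) t := by
    have hinv := (hasDerivAt_inv h0).hasFDerivAt.restrictScalars ℝ
    have := hN.mul (hinv.comp t hD)
    simp only [div_eq_mul_inv]
    refine this.congr_fderiv ?_
    ext v
    simp
    field_simp
    ring
  rw [differentiableAt_complex_iff_differentiableAt_real, hq.fderiv]
  refine ⟨hq.differentiableAt, ?_⟩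
  simp only [smul_apply, sub_apply, smul_eq_mul]
  linear_combination ((D t) ^ 2)⁻¹ * h

variable {k : ℝ}

/-- The factors depend on `t.re` or `t.im` alone and have known derivatives, so the Cauchy-Riemann
equation is a polynomial identity modulo `cn² = 1 - sn²`, `dn² = 1 - k² sn²` for both moduli, `k'² =
1 - k²` and `I² = -1`. -/
lemma differentiableAt_jacobi_quotients (hk : k ∈ Ioo (0 : ℝ) 1) {t : ℂ} (ht : Regular k t) :
    DifferentiableAt ℂ (sn k) t ∧ DifferentiableAt ℂ (cn k) t ∧ DifferentiableAt ℂ (dn k) t := by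
  have hk' := coModulus_mem_Ioo hk
  have hs := hasFDerivAt_ofReal_comp_re (hasDerivAt_snR hk t.re)
  have hc := hasFDerivAt_ofReal_comp_re (hasDerivAt_cnR hk t.re)
  have hd := hasFDerivAt_ofReal_comp_re (hasDerivAt_dnR hk t.re)
  have hs' := hasFDerivAt_ofReal_comp_im (hasDerivAt_snR hk' t.im)
  have hc' := hasFDerivAt_ofReal_comp_im (hasDerivAt_cnR hk' t.im)
  have hd' := hasFDerivAt_ofReal_comp_im (hasDerivAt_dnR hk' t.im)
  have h1 : (cnR k t.re : ℂ) ^ 2 = 1 - snR k t.re ^ 2 := by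
    exact_mod_cast eq_sub_of_add_eq' (snR_sq_add_cnR_sq k t.re)
  have h2 : (dnR k t.re : ℂ) ^ 2 = 1 - k ^ 2 * snR k t.re ^ 2 := by
    exact_mod_cast dnR_sq hk t.re
  have h3 : (cnR (coModulus k) t.im : ℂ) ^ 2 = 1 - snR (coModulus k) t.im ^ 2 := by
    exact_mod_cast eq_sub_of_add_eq' (snR_sq_add_cnR_sq (coModulus k) t.im)
  have hm : (coModulus k : ℂ) ^ 2 = 1 - k ^ 2 := by exact_mod_cast coModulus_sq hk
  have h4 : (dnR (coModulus k) t.im : ℂ) ^ 2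
      = 1 - (1 - k ^ 2) * snR (coModulus k) t.im ^ 2 := by
    rw [← hm]; exact_mod_cast dnR_sq hk' t.im
  have h0 : (cnR (coModulus k) t.im : ℂ) ^ 2
      + (k : ℂ) ^ 2 * snR k t.re ^ 2 * snR (coModulus k) t.im ^ 2 ≠ 0 := by
    exact_mod_cast ht
  have hI := I_sq
  have hD : HasFDerivAt (fun t : ℂ => (cnR (coModulus k) t.im : ℂ) ^ 2
      + (k : ℂ) ^ 2 * snR k t.re ^ 2 * snR (coModulus k) t.im ^ 2) _ t :=
    (hc'.pow 2).add (((hs.pow 2).const_mul ((k : ℂ) ^ 2)).mul (hs'.pow 2))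
  refine ⟨?_, ?_, ?_⟩
  · have hN : HasFDerivAt (fun t : ℂ => (snR k t.re : ℂ) * dnR (coModulus k) t.im
        + I * (cnR k t.re * dnR k t.re * snR (coModulus k) t.im * cnR (coModulus k) t.im)) _ t :=
      (hs.mul hd').add (((((hc.mul hd).mul hs').mul hc')).const_mul I)
    have e : sn k = fun t : ℂ => ((snR k t.re : ℂ) * dnR (coModulus k) t.im
        + I * (cnR k t.re * dnR k t.re * snR (coModulus k) t.im * cnR (coModulus k) t.im))
        / ((cnR (coModulus k) t.im : ℂ) ^ 2
          + (k : ℂ) ^ 2 * snR k t.re ^ 2 * snR (coModulus k) t.im ^ 2) := funext fun t => by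
      rw [sn, jacobiDen]; push_cast; ring
    rw [e]
    refine differentiableAt_div_of_cauchyRiemann hN hD h0 ?_
    simp [hm]
    grind
  · have hN : HasFDerivAt (fun t : ℂ => (cnR k t.re : ℂ) * cnR (coModulus k) t.im
        - I * (snR k t.re * dnR k t.re * snR (coModulus k) t.im * dnR (coModulus k) t.im)) _ t :=
      (hc.mul hc').sub (((((hs.mul hd).mul hs').mul hd')).const_mul I)
    have e : cn k = fun t : ℂ => ((cnR k t.re : ℂ) * cnR (coModulus k) t.im
        - I * (snR k t.re * dnR k t.re * snR (coModulus k) t.im * dnR (coModulus k) t.im))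
        / ((cnR (coModulus k) t.im : ℂ) ^ 2
          + (k : ℂ) ^ 2 * snR k t.re ^ 2 * snR (coModulus k) t.im ^ 2) := funext fun t => by
      rw [cn, jacobiDen]; push_cast; ring
    rw [e]
    refine differentiableAt_div_of_cauchyRiemann hN hD h0 ?_
    simp [hm]
    grind
  · have hN : HasFDerivAt (fun t : ℂ => (dnR k t.re : ℂ) * cnR (coModulus k) t.im
          * dnR (coModulus k) t.im
        - I * (k ^ 2 * snR k t.re * cnR k t.re * snR (coModulus k) t.im)) _ t :=
      ((hd.mul hc').mul hd').sub ((((hs.const_mul ((k : ℂ) ^ 2)).mul hc).mul hs').const_mul I)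
    have e : dn k = fun t : ℂ => ((dnR k t.re : ℂ) * cnR (coModulus k) t.im
          * dnR (coModulus k) t.im
        - I * (k ^ 2 * snR k t.re * cnR k t.re * snR (coModulus k) t.im))
        / ((cnR (coModulus k) t.im : ℂ) ^ 2
          + (k : ℂ) ^ 2 * snR k t.re ^ 2 * snR (coModulus k) t.im ^ 2) := funext fun t => by
      rw [dn, jacobiDen]; push_cast; ring
    rw [e]
    refine differentiableAt_div_of_cauchyRiemann hN hD h0 ?_
    simp [hm]
    grind

lemma differentiableAt_sn (hk : k ∈ Ioo (0 : ℝ) 1) {t : ℂ} (ht : Regular k t) :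
    DifferentiableAt ℂ (sn k) t := (differentiableAt_jacobi_quotients hk ht).1

lemma differentiableAt_cn (hk : k ∈ Ioo (0 : ℝ) 1) {t : ℂ} (ht : Regular k t) :
    DifferentiableAt ℂ (cn k) t := (differentiableAt_jacobi_quotients hk ht).2.1

lemma differentiableAt_dn (hk : k ∈ Ioo (0 : ℝ) 1) {t : ℂ} (ht : Regular k t) :
    DifferentiableAt ℂ (dn k) t := (differentiableAt_jacobi_quotients hk ht).2.2

/-! ### The poles -/

lemma continuous_snR (hk : k ∈ Ioo (0 : ℝ) 1) : Continuous (snR k) :=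
  Real.continuous_sin.comp (continuous_am hk)

lemma continuous_cnR (hk : k ∈ Ioo (0 : ℝ) 1) : Continuous (cnR k) :=
  Real.continuous_cos.comp (continuous_am hk)

lemma continuous_jacobiDen (hk : k ∈ Ioo (0 : ℝ) 1) : Continuous (jacobiDen k) := by
  have h1 := continuous_snR hk
  have h2 := continuous_snR (coModulus_mem_Ioo hk)
  have h3 := continuous_cnR (coModulus_mem_Ioo hk)
  unfold jacobiDen
  fun_prop

lemma isOpen_setOf_regular (hk : k ∈ Ioo (0 : ℝ) 1) : IsOpen {t | Regular k t} :=
  isOpen_ne_fun (continuous_jacobiDen hk) continuous_const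

/-- The denominator is a sum of two squares, and `sn`, `cn` of modulus `k'` have no common zero. -/
lemma not_regular_iff (hk : k ∈ Ioo (0 : ℝ) 1) (t : ℂ) :
    ¬ Regular k t ↔ snR k t.re = 0 ∧ cnR (coModulus k) t.im = 0 := by
  have h := snR_sq_add_cnR_sq (coModulus k) t.im
  have hk0 := hk.1.ne'
  rw [Regular, not_not, jacobiDen]
  constructor
  · intro h0
    have hc : cnR (coModulus k) t.im = 0 := by
      rw [← sq_eq_zero_iff]
      nlinarith [sq_nonneg (cnR (coModulus k) t.im),
        sq_nonneg (k * snR k t.re * snR (coModulus k) t.im)]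
    rw [hc] at h h0
    refine ⟨?_, hc⟩
    have h1 : snR (coModulus k) t.im ^ 2 = 1 := by linarith
    rw [h1] at h0
    simpa [hk0] using h0
  · rintro ⟨h1, h2⟩
    simp [h1, h2]

lemma countable_setOf_not_regular (hk : k ∈ Ioo (0 : ℝ) 1) : {t | ¬ Regular k t}.Countable := by
  have h := (countable_setOf_snR_eq_zero hk).prod
    (countable_setOf_cnR_eq_zero (coModulus_mem_Ioo hk))
  refine (h.image fun p => (⟨p.1, p.2⟩ : ℂ)).mono fun t ht => ?_
  exact ⟨(t.re, t.im), (not_regular_iff hk t).1 ht, rfl⟩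

lemma jacobiDen_ofReal (hk : k ∈ Ioo (0 : ℝ) 1) (x : ℝ) : jacobiDen k x = 1 := by
  simp [jacobiDen, snR_zero (coModulus_mem_Ioo hk), cnR_zero (coModulus_mem_Ioo hk)]

lemma regular_ofReal (hk : k ∈ Ioo (0 : ℝ) 1) (x : ℝ) : Regular k x := by
  simp [Regular, jacobiDen_ofReal hk]

lemma sn_ofReal (hk : k ∈ Ioo (0 : ℝ) 1) (x : ℝ) : sn k x = snR k x := by
  simp [sn, jacobiDen_ofReal hk, snR_zero (coModulus_mem_Ioo hk), dnR_zero (coModulus_mem_Ioo hk)]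

lemma cn_ofReal (hk : k ∈ Ioo (0 : ℝ) 1) (x : ℝ) : cn k x = cnR k x := by
  simp [cn, jacobiDen_ofReal hk, snR_zero (coModulus_mem_Ioo hk), cnR_zero (coModulus_mem_Ioo hk)]

lemma dn_ofReal (hk : k ∈ Ioo (0 : ℝ) 1) (x : ℝ) : dn k x = dnR k x := by
  simp [dn, jacobiDen_ofReal hk, snR_zero (coModulus_mem_Ioo hk), cnR_zero (coModulus_mem_Ioo hk),
    dnR_zero (coModulus_mem_Ioo hk)]

/-! ### Extension of identities from real to complex arguments -/

/-- The identity theorem: the complement of a countable set in the plane is connected, and it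
contains a real point because the line is uncountable. Nearby real points, where `F` vanishes,
accumulate there. -/
lemma eq_zero_of_eq_zero_on_reals {F : ℂ → ℂ} {U : Set ℂ} (hU : IsOpen U) (hUc : Uᶜ.Countable)
    (hF : DifferentiableOn ℂ F U) (h : ∀ x : ℝ, (x : ℂ) ∈ U → F x = 0) {t : ℂ} (ht : t ∈ U) :
    F t = 0 := by
  have hpre : IsPreconnected U := by
    have := hUc.isConnected_compl_of_one_lt_rank (by simp)
    rw [compl_compl] at this
    exact this.isPreconnected
  obtain ⟨x, hx⟩ : ∃ x : ℝ, (x : ℂ) ∈ U := by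
    by_contra! hne
    refine not_countable_univ (α := ℝ) ?_
    exact (hUc.preimage ofReal_injective).mono fun x _ => hne x
  have hreal : ∀ᶠ y : ℝ in nhdsWithin x {x}ᶜ, F y = 0 := by
    have h1 : ∀ᶠ y : ℝ in nhds x, (y : ℂ) ∈ U :=
      continuous_ofReal.continuousAt.eventually (hU.mem_nhds hx)
    exact (h1.mono h).filter_mono nhdsWithin_le_nhds
  have htend : Filter.Tendsto (fun y : ℝ => (y : ℂ)) (nhdsWithin x {x}ᶜ)
      (nhdsWithin (x : ℂ) {(x : ℂ)}ᶜ) :=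
    continuous_ofReal.continuousWithinAt.tendsto_nhdsWithin fun y hy => by simpa using hy
  exact (hF.analyticOnNhd hU).eqOn_zero_of_preconnected_of_frequently_eq_zero hpre hx
    (htend.frequently hreal.frequently) ht

/-- The triple `(sn t, cn t, dn t)`. -/
noncomputable def jacobiTriple (k : ℝ) (t : ℂ) : ℂ × ℂ × ℂ := (sn k t, cn k t, dn k t)

lemma differentiableAt_jacobiTriple (hk : k ∈ Ioo (0 : ℝ) 1) {t : ℂ} (ht : Regular k t) :
    DifferentiableAt ℂ (jacobiTriple k) t :=
  (differentiableAt_sn hk ht).prodMk ((differentiableAt_cn hk ht).prodMk (differentiableAt_dn hk ht))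

lemma countable_setOf_not_regular_add (hk : k ∈ Ioo (0 : ℝ) 1) (c : ℂ) :
    {t | ¬ Regular k (t + c)}.Countable :=
  (countable_setOf_not_regular hk).preimage (add_left_injective c)

/-- An identity between the values of the Jacobi functions at `t`, `θ` and `t + θ` that holds for
real arguments holds for all complex arguments that are not poles. -/
lemma jacobi_identity_of_real (hk : k ∈ Ioo (0 : ℝ) 1)
    {P : (ℂ × ℂ × ℂ) × (ℂ × ℂ × ℂ) × (ℂ × ℂ × ℂ) → ℂ} (hP : Differentiable ℂ P)
    (h : ∀ x y : ℝ, P (jacobiTriple k x, jacobiTriple k y, jacobiTriple k (x + y)) = 0)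
    {t θ : ℂ} (ht : Regular k t) (hθ : Regular k θ) (htθ : Regular k (t + θ)) :
    P (jacobiTriple k t, jacobiTriple k θ, jacobiTriple k (t + θ)) = 0 := by
  have hopen := isOpen_setOf_regular hk
  -- The variables are released one at a time: first `t` becomes complex with a real shift `y`, then
  -- `t` is frozen and the shift becomes complex.
  have hstep (y : ℝ) {t : ℂ} (ht : Regular k t) (hty : Regular k (t + y)) :
      P (jacobiTriple k t, jacobiTriple k y, jacobiTriple k (t + y)) = 0 := by
    refine eq_zero_of_eq_zero_on_reals
      (F := fun t => P (jacobiTriple k t, jacobiTriple k y, jacobiTriple k (t + y)))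
      (U := {t | Regular k t} ∩ {t | Regular k (t + y)})
      (hopen.inter (hopen.preimage (continuous_add_const (y : ℂ)))) ?_ ?_ (fun x _ => h x y)
      ⟨ht, hty⟩
    · rw [compl_inter]
      exact (countable_setOf_not_regular hk).union (countable_setOf_not_regular_add hk y)
    · intro t ht
      have h1 := differentiableAt_jacobiTriple hk ht.1
      have h2 := ((differentiableAt_jacobiTriple hk ht.2).comp t
        ((differentiableAt_id).add_const (y : ℂ)))
      exact ((hP _).comp t (h1.prodMk ((differentiableAt_const _).prodMk h2))).differentiableWithinAt
  refine eq_zero_of_eq_zero_on_reals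
    (F := fun θ => P (jacobiTriple k t, jacobiTriple k θ, jacobiTriple k (t + θ)))
    (U := {θ | Regular k θ} ∩ {θ | Regular k (t + θ)})
    (hopen.inter (hopen.preimage (continuous_const_add t))) ?_ ?_
    (fun y hy => hstep y ht hy.2) ⟨hθ, htθ⟩
  · rw [compl_inter]
    refine (countable_setOf_not_regular hk).union ?_
    exact (countable_setOf_not_regular hk).preimage (add_right_injective t)
  · intro θ hθ
    have h1 := differentiableAt_jacobiTriple hk hθ.1
    have h2 := ((differentiableAt_jacobiTriple hk hθ.2).comp θ
        ((differentiableAt_id).const_add t))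
    exact ((hP _).comp θ ((differentiableAt_const _).prodMk (h1.prodMk h2))).differentiableWithinAt

/-! ### Pythagorean, addition and biquadratic identities at complex arguments. -/

lemma sn_sq_add_cn_sq (hk : k ∈ Ioo (0 : ℝ) 1) {t : ℂ} (ht : Regular k t) :
    sn k t ^ 2 + cn k t ^ 2 = 1 := by
  refine sub_eq_zero.1 (jacobi_identity_of_real hk (P := fun p => p.1.1 ^ 2 + p.1.2.1 ^ 2 - 1)
    -- The polynomial involves only the values at `t`, so the second argument is a dummy, set to
    -- `0`.
    (by fun_prop) (fun x y => ?_) ht (regular_ofReal hk 0) (by simpa using ht))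
  simp only [jacobiTriple, sn_ofReal hk, cn_ofReal hk]
  exact_mod_cast sub_eq_zero.2 (snR_sq_add_cnR_sq k x)

lemma dn_sq (hk : k ∈ Ioo (0 : ℝ) 1) {t : ℂ} (ht : Regular k t) :
    dn k t ^ 2 = 1 - k ^ 2 * sn k t ^ 2 := by
  refine sub_eq_zero.1 (jacobi_identity_of_real hk
    (P := fun p => p.1.2.2 ^ 2 - (1 - k ^ 2 * p.1.1 ^ 2))
    (by fun_prop) (fun x y => ?_) ht (regular_ofReal hk 0) (by simpa using ht))
  simp only [jacobiTriple, sn_ofReal hk, dn_ofReal hk]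
  exact_mod_cast sub_eq_zero.2 (dnR_sq hk x)

lemma sn_add (hk : k ∈ Ioo (0 : ℝ) 1) {t θ : ℂ} (ht : Regular k t) (hθ : Regular k θ)
    (htθ : Regular k (t + θ)) :
    sn k (t + θ) * (1 - k ^ 2 * sn k t ^ 2 * sn k θ ^ 2)
      = sn k t * cn k θ * dn k θ + sn k θ * cn k t * dn k t := by
  refine sub_eq_zero.1 (jacobi_identity_of_real hk
    (P := fun p => p.2.2.1 * (1 - k ^ 2 * p.1.1 ^ 2 * p.2.1.1 ^ 2)
      - (p.1.1 * p.2.1.2.1 * p.2.1.2.2 + p.2.1.1 * p.1.2.1 * p.1.2.2))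
    (by fun_prop) (fun x y => ?_) ht hθ htθ)
  simp only [jacobiTriple, ← ofReal_add, sn_ofReal hk, cn_ofReal hk, dn_ofReal hk]
  exact_mod_cast sub_eq_zero.2 (snR_add hk x y)

lemma cn_add (hk : k ∈ Ioo (0 : ℝ) 1) {t θ : ℂ} (ht : Regular k t) (hθ : Regular k θ)
    (htθ : Regular k (t + θ)) :
    cn k (t + θ) * (1 - k ^ 2 * sn k t ^ 2 * sn k θ ^ 2)
      = cn k t * cn k θ - sn k t * sn k θ * dn k t * dn k θ := by
  refine sub_eq_zero.1 (jacobi_identity_of_real hk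
    (P := fun p => p.2.2.2.1 * (1 - k ^ 2 * p.1.1 ^ 2 * p.2.1.1 ^ 2)
      - (p.1.2.1 * p.2.1.2.1 - p.1.1 * p.2.1.1 * p.1.2.2 * p.2.1.2.2))
    (by fun_prop) (fun x y => ?_) ht hθ htθ)
  simp only [jacobiTriple, ← ofReal_add, sn_ofReal hk, cn_ofReal hk, dn_ofReal hk]
  exact_mod_cast sub_eq_zero.2 (cnR_add hk x y)

/-- The biquadratic relation between `sn t` and `sn (t + θ)`. -/
lemma sn_biquadratic (hk : k ∈ Ioo (0 : ℝ) 1) {t θ : ℂ} (ht : Regular k t) (hθ : Regular k θ)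
    (htθ : Regular k (t + θ)) :
    (1 - k ^ 2 * sn k t ^ 2 * sn k θ ^ 2) * sn k (t + θ) ^ 2
      - 2 * cn k θ * dn k θ * sn k t * sn k (t + θ) + sn k t ^ 2 - sn k θ ^ 2 = 0 := by
  refine jacobi_identity_of_real hk
    (P := fun p => (1 - k ^ 2 * p.1.1 ^ 2 * p.2.1.1 ^ 2) * p.2.2.1 ^ 2
      - 2 * p.2.1.2.1 * p.2.1.2.2 * p.1.1 * p.2.2.1 + p.1.1 ^ 2 - p.2.1.1 ^ 2)
    (by fun_prop) (fun x y => ?_) ht hθ htθ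
  simp only [jacobiTriple, ← ofReal_add, sn_ofReal hk, cn_ofReal hk, dn_ofReal hk]
  norm_cast
  have h0 := (one_sub_sq_mul_snR_sq_mul_snR_sq_pos hk x y).ne'
  have h := snR_add hk x y
  have h1 := eq_sub_of_add_eq' (snR_sq_add_cnR_sq k x)
  have h2 := eq_sub_of_add_eq' (snR_sq_add_cnR_sq k y)
  have h3 := dnR_sq hk x
  have h4 := dnR_sq hk y
  -- Write the addition theorem as `ΔS = a + b`, with `a = sn x cn y dn y` and `b = sn y cn x dn x`.
  -- By `e`, `Δ` times the claimed expression is `(ΔS - a)² - b²`, which has the factor `ΔS - a -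
  -- b`.
  have e : (snR k y * cnR k x * dnR k x) ^ 2 - (snR k x * cnR k y * dnR k y) ^ 2
      + (1 - k ^ 2 * snR k x ^ 2 * snR k y ^ 2) * (snR k x ^ 2 - snR k y ^ 2) = 0 := by
    simp only [mul_pow, h1, h2, h3, h4]
    ring
  refine (mul_eq_zero_iff_left h0).1 ?_
  linear_combination (snR k (x + y) * (1 - k ^ 2 * snR k x ^ 2 * snR k y ^ 2)
    - snR k x * cnR k y * dnR k y + snR k y * cnR k x * dnR k x) * h + e

/-- The biquadratic relation between `cn t` and `cn (t + θ)`. -/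
lemma cn_biquadratic (hk : k ∈ Ioo (0 : ℝ) 1) {t θ : ℂ} (ht : Regular k t) (hθ : Regular k θ)
    (htθ : Regular k (t + θ)) :
    (1 - k ^ 2 * sn k t ^ 2 * sn k θ ^ 2) * cn k (t + θ) ^ 2
      - 2 * cn k θ * cn k t * cn k (t + θ) + dn k θ ^ 2 * cn k t ^ 2
      + (k ^ 2 - 1) * sn k θ ^ 2 = 0 := by
  refine jacobi_identity_of_real hk
    (P := fun p => (1 - k ^ 2 * p.1.1 ^ 2 * p.2.1.1 ^ 2) * p.2.2.2.1 ^ 2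
      - 2 * p.2.1.2.1 * p.1.2.1 * p.2.2.2.1 + p.2.1.2.2 ^ 2 * p.1.2.1 ^ 2
      + (k ^ 2 - 1) * p.2.1.1 ^ 2)
    (by fun_prop) (fun x y => ?_) ht hθ htθ
  simp only [jacobiTriple, ← ofReal_add, sn_ofReal hk, cn_ofReal hk, dn_ofReal hk]
  norm_cast
  have h0 := (one_sub_sq_mul_snR_sq_mul_snR_sq_pos hk x y).ne'
  have h := cnR_add hk x y
  have h1 := eq_sub_of_add_eq' (snR_sq_add_cnR_sq k x)
  have h2 := eq_sub_of_add_eq' (snR_sq_add_cnR_sq k y)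
  have h3 := dnR_sq hk x
  have h4 := dnR_sq hk y
  -- Again a difference of two squares, now with `a = cn x cn y` and `b = -sn x sn y dn x dn y`.
  have e : (snR k x * snR k y * dnR k x * dnR k y) ^ 2 - (cnR k x * cnR k y) ^ 2
      + (1 - k ^ 2 * snR k x ^ 2 * snR k y ^ 2)
        * (dnR k y ^ 2 * cnR k x ^ 2 + (k ^ 2 - 1) * snR k y ^ 2) = 0 := by
    simp only [mul_pow, h1, h2, h3, h4]
    ring
  refine (mul_eq_zero_iff_left h0).1 ?_
  linear_combination (cnR k (x + y) * (1 - k ^ 2 * snR k x ^ 2 * snR k y ^ 2)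
    - cnR k x * cnR k y - snR k x * snR k y * dnR k x * dnR k y) * h + e

end Holomorphy

section Symmetries

open Complex

variable {k : ℝ}

/-! ### Symmetries -/

lemma jacobiDen_neg (hk : k ∈ Ioo (0 : ℝ) 1) (t : ℂ) : jacobiDen k (-t) = jacobiDen k t := by
  simp [jacobiDen, snR_neg hk, snR_neg (coModulus_mem_Ioo hk), cnR_neg (coModulus_mem_Ioo hk)]

lemma regular_neg (hk : k ∈ Ioo (0 : ℝ) 1) {t : ℂ} : Regular k (-t) ↔ Regular k t := by
  simp [Regular, jacobiDen_neg hk]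

lemma sn_neg (hk : k ∈ Ioo (0 : ℝ) 1) (t : ℂ) : sn k (-t) = -sn k t := by
  have hk' := coModulus_mem_Ioo hk
  simp only [sn, jacobiDen_neg hk, neg_re, neg_im, snR_neg hk, cnR_neg hk, dnR_neg hk, snR_neg hk',
    cnR_neg hk', dnR_neg hk']
  push_cast
  ring

lemma cn_neg (hk : k ∈ Ioo (0 : ℝ) 1) (t : ℂ) : cn k (-t) = cn k t := by
  have hk' := coModulus_mem_Ioo hk
  simp only [cn, jacobiDen_neg hk, neg_re, neg_im, snR_neg hk, cnR_neg hk, dnR_neg hk, snR_neg hk',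
    cnR_neg hk', dnR_neg hk']
  push_cast
  ring

lemma dn_neg (hk : k ∈ Ioo (0 : ℝ) 1) (t : ℂ) : dn k (-t) = dn k t := by
  have hk' := coModulus_mem_Ioo hk
  simp only [dn, jacobiDen_neg hk, neg_re, neg_im, snR_neg hk, cnR_neg hk, dnR_neg hk, snR_neg hk',
    cnR_neg hk', dnR_neg hk']
  push_cast
  ring

lemma jacobiDen_add_two_quarterPeriod (hk : k ∈ Ioo (0 : ℝ) 1) (t : ℂ) :
    jacobiDen k (t + 2 * quarterPeriod k) = jacobiDen k t := by
  simp [jacobiDen, snR_add_two_quarterPeriod hk]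

lemma regular_add_two_quarterPeriod (hk : k ∈ Ioo (0 : ℝ) 1) {t : ℂ} :
    Regular k (t + 2 * quarterPeriod k) ↔ Regular k t := by
  simp [Regular, jacobiDen_add_two_quarterPeriod hk]

lemma sn_add_two_quarterPeriod (hk : k ∈ Ioo (0 : ℝ) 1) (t : ℂ) :
    sn k (t + 2 * quarterPeriod k) = -sn k t := by
  rw [sn, jacobiDen_add_two_quarterPeriod hk, sn, ← neg_div]
  congr 1
  simp [snR_add_two_quarterPeriod hk, cnR_add_two_quarterPeriod hk, dnR_add_two_quarterPeriod hk]
  ring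

lemma cn_add_two_quarterPeriod (hk : k ∈ Ioo (0 : ℝ) 1) (t : ℂ) :
    cn k (t + 2 * quarterPeriod k) = -cn k t := by
  rw [cn, jacobiDen_add_two_quarterPeriod hk, cn, ← neg_div]
  congr 1
  simp [snR_add_two_quarterPeriod hk, cnR_add_two_quarterPeriod hk, dnR_add_two_quarterPeriod hk]
  ring

lemma regular_two_quarterPeriod_sub (hk : k ∈ Ioo (0 : ℝ) 1) {t : ℂ} :
    Regular k (2 * quarterPeriod k - t) ↔ Regular k t := by
  rw [sub_eq_neg_add, regular_add_two_quarterPeriod hk, regular_neg hk]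

lemma sn_two_quarterPeriod_sub (hk : k ∈ Ioo (0 : ℝ) 1) (t : ℂ) :
    sn k (2 * quarterPeriod k - t) = sn k t := by
  rw [sub_eq_neg_add, sn_add_two_quarterPeriod hk, sn_neg hk, neg_neg]

lemma cn_two_quarterPeriod_sub (hk : k ∈ Ioo (0 : ℝ) 1) (t : ℂ) :
    cn k (2 * quarterPeriod k - t) = -cn k t := by
  rw [sub_eq_neg_add, cn_add_two_quarterPeriod hk, cn_neg hk]

/-! ### `sn` takes every value -/

lemma periodic_jacobiDen_re (hk : k ∈ Ioo (0 : ℝ) 1) :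
    Function.Periodic (jacobiDen k) ((4 * quarterPeriod k : ℝ) : ℂ) := fun t => by
  rw [show t + ((4 * quarterPeriod k : ℝ) : ℂ)
    = t + 2 * quarterPeriod k + 2 * quarterPeriod k by push_cast; ring]
  simp only [jacobiDen_add_two_quarterPeriod hk]

lemma periodic_sn_re (hk : k ∈ Ioo (0 : ℝ) 1) :
    Function.Periodic (sn k) ((4 * quarterPeriod k : ℝ) : ℂ) := fun t => by
  rw [show t + ((4 * quarterPeriod k : ℝ) : ℂ)
    = t + 2 * quarterPeriod k + 2 * quarterPeriod k by push_cast; ring]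
  simp only [sn_add_two_quarterPeriod hk, neg_neg]

lemma periodic_jacobiDen_im (hk : k ∈ Ioo (0 : ℝ) 1) :
    Function.Periodic (jacobiDen k) ((2 * quarterPeriod (coModulus k) : ℝ) * I) := fun t => by
  have hk' := coModulus_mem_Ioo hk
  have h1 : (t + (2 * quarterPeriod (coModulus k) : ℝ) * I).re = t.re := by simp
  have h2 : (t + (2 * quarterPeriod (coModulus k) : ℝ) * I).im
    = t.im + 2 * quarterPeriod (coModulus k) := by simp
  rw [jacobiDen, jacobiDen, h1, h2, snR_add_two_quarterPeriod hk', cnR_add_two_quarterPeriod hk']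
  ring

lemma periodic_sn_im (hk : k ∈ Ioo (0 : ℝ) 1) :
    Function.Periodic (sn k) ((2 * quarterPeriod (coModulus k) : ℝ) * I) := fun t => by
  have hk' := coModulus_mem_Ioo hk
  have h1 : (t + (2 * quarterPeriod (coModulus k) : ℝ) * I).re = t.re := by simp
  have h2 : (t + (2 * quarterPeriod (coModulus k) : ℝ) * I).im
    = t.im + 2 * quarterPeriod (coModulus k) := by simp
  rw [sn, periodic_jacobiDen_im hk, sn, h1, h2, snR_add_two_quarterPeriod hk',
    cnR_add_two_quarterPeriod hk', dnR_add_two_quarterPeriod hk']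
  push_cast
  ring

/-- Every `t` is congruent modulo periods to a point of a compact rectangle. -/
lemma exists_mem_rectangle (hk : k ∈ Ioo (0 : ℝ) 1) (t : ℂ) :
    ∃ u ∈ Icc 0 (4 * quarterPeriod k) ×ℂ Icc 0 (2 * quarterPeriod (coModulus k)),
      jacobiDen k u = jacobiDen k t ∧ sn k u = sn k t := by
  have h1 : 0 < 4 * quarterPeriod k := by linarith [quarterPeriod_pos hk]
  have h2 : 0 < 2 * quarterPeriod (coModulus k) := by
    linarith [quarterPeriod_pos (coModulus_mem_Ioo hk)]
  obtain ⟨m, hm, -⟩ := existsUnique_sub_zsmul_mem_Ico h1 t.re 0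
  obtain ⟨n, hn, -⟩ := existsUnique_sub_zsmul_mem_Ico h2 t.im 0
  refine ⟨t - m • ((4 * quarterPeriod k : ℝ) : ℂ)
    - n • ((2 * quarterPeriod (coModulus k) : ℝ) * I), ⟨?_, ?_⟩, ?_, ?_⟩
  · rw [zero_add] at hm
    simpa using Ico_subset_Icc_self hm
  · rw [zero_add] at hn
    simpa using Ico_subset_Icc_self hn
  · rw [(periodic_jacobiDen_im hk).sub_zsmul_eq, (periodic_jacobiDen_re hk).sub_zsmul_eq]
  · rw [(periodic_sn_im hk).sub_zsmul_eq, (periodic_sn_re hk).sub_zsmul_eq]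

/-- One factor of the denominator cancels. The right side is continuous and equals `1` wherever the
denominator vanishes, so `sn` tends to infinity at the poles. -/
lemma normSq_sn_mul_jacobiDen (hk : k ∈ Ioo (0 : ℝ) 1) {t : ℂ} (ht : Regular k t) :
    normSq (sn k t) * jacobiDen k t
      = snR k t.re ^ 2 * cnR (coModulus k) t.im ^ 2 + snR (coModulus k) t.im ^ 2 := by
  have h1 := eq_sub_of_add_eq' (snR_sq_add_cnR_sq k t.re)
  have h2 := dnR_sq hk t.re
  have h3 := eq_sub_of_add_eq' (snR_sq_add_cnR_sq (coModulus k) t.im)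
  have h4 := dnR_sq (coModulus_mem_Ioo hk) t.im
  rw [coModulus_sq hk] at h4
  have hN : normSq ((snR k t.re : ℂ) * dnR (coModulus k) t.im
      + I * (cnR k t.re * dnR k t.re * snR (coModulus k) t.im * cnR (coModulus k) t.im))
      = (snR k t.re * dnR (coModulus k) t.im) ^ 2
        + (cnR k t.re * dnR k t.re * snR (coModulus k) t.im * cnR (coModulus k) t.im) ^ 2 := by
    rw [mul_comm I, ← ofReal_mul, ← ofReal_mul, ← ofReal_mul, ← ofReal_mul, normSq_add_mul_I]
  have ht : jacobiDen k t ≠ 0 := ht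
  rw [sn, map_div₀, hN, normSq_ofReal]
  field_simp
  unfold jacobiDen
  simp only [h1, h2, h3, h4]
  ring

/-- Preimages of a convergent sequence of values can be moved into a compact period rectangle. A
limit point `v` of them cannot be a pole, since the values of `sn` stay bounded; hence the limit is
`sn k v`. -/
lemma isClosed_image_sn (hk : k ∈ Ioo (0 : ℝ) 1) : IsClosed (sn k '' {t | Regular k t}) := by
  have hk' := coModulus_mem_Ioo hk
  rw [← isSeqClosed_iff_isClosed]
  intro w z hw hz
  choose t ht htw using hw
  choose u hu hud hus using fun n => exists_mem_rectangle hk (t n)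
  have hcomp : IsCompact
      (Icc 0 (4 * quarterPeriod k) ×ℂ Icc 0 (2 * quarterPeriod (coModulus k))) :=
    isCompact_Icc.reProdIm isCompact_Icc
  obtain ⟨v, -, φ, hφ, hv⟩ := hcomp.tendsto_subseq hu
  have hureg (n : ℕ) : Regular k (u n) := by
    rw [Regular, hud]; exact ht n
  have hsn : Filter.Tendsto (fun n => sn k (u (φ n))) Filter.atTop (nhds z) := by
    simp only [hus, htw]
    exact hz.comp hφ.tendsto_atTop
  have hvreg : Regular k v := by
    by_contra hnot
    have hlim1 : Filter.Tendsto (fun n => normSq (sn k (u (φ n))) * jacobiDen k (u (φ n)))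
        Filter.atTop (nhds (normSq z * jacobiDen k v)) :=
      ((continuous_normSq.tendsto z).comp hsn).mul
        (((continuous_jacobiDen hk).tendsto v).comp hv)
    have hcont : Continuous fun t : ℂ =>
        snR k t.re ^ 2 * cnR (coModulus k) t.im ^ 2 + snR (coModulus k) t.im ^ 2 := by
      have h1 := continuous_snR hk
      have h2 := continuous_snR hk'
      have h3 := continuous_cnR hk'
      fun_prop
    have hlim2 := (hcont.tendsto v).comp hv
    -- At a pole the left limit is `0` and the right one is `1`.
    have heq := tendsto_nhds_unique (hlim1.congr fun n =>
      normSq_sn_mul_jacobiDen hk (hureg (φ n))) hlim2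
    have h0 : jacobiDen k v = 0 := not_not.1 hnot
    obtain ⟨h1, h2⟩ := (not_regular_iff hk v).1 hnot
    have h3 := snR_sq_add_cnR_sq (coModulus k) v.im
    rw [h0, h1, h2] at heq
    rw [h2] at h3
    linarith
  refine ⟨v, hvreg, ?_⟩
  exact tendsto_nhds_unique
    ((differentiableAt_sn hk hvreg).continuousAt.tendsto.comp hv) hsn

/-- Open mapping theorem on the connected set of regular points; `sn` is not constant because `sn 0
= 0` and `sn K = 1`. -/
lemma isOpen_image_sn (hk : k ∈ Ioo (0 : ℝ) 1) : IsOpen (sn k '' {t | Regular k t}) := by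
  have hopen := isOpen_setOf_regular hk
  have hpre : IsPreconnected {t | Regular k t} := by
    have := (countable_setOf_not_regular hk).isConnected_compl_of_one_lt_rank (E := ℂ) (by simp)
    have hc : {t | ¬ Regular k t}ᶜ = {t | Regular k t} := by ext; simp
    rw [hc] at this
    exact this.isPreconnected
  have han : AnalyticOnNhd ℂ (sn k) {t | Regular k t} :=
    DifferentiableOn.analyticOnNhd
      (fun t ht => (differentiableAt_sn hk ht).differentiableWithinAt) hopen
  rcases han.is_constant_or_isOpen hpre with ⟨w, hw⟩ | h
  · have h0 := hw _ (regular_ofReal hk 0)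
    have h1 := hw _ (regular_ofReal hk (quarterPeriod k))
    rw [sn_ofReal hk, snR_zero hk] at h0
    rw [sn_ofReal hk, snR_quarterPeriod hk, ← h0] at h1
    simp at h1
  · exact h _ subset_rfl hopen

lemma exists_sn_eq (hk : k ∈ Ioo (0 : ℝ) 1) (w : ℂ) : ∃ t, Regular k t ∧ sn k t = w := by
  have h : sn k '' {t | Regular k t} = univ :=
    IsClopen.eq_univ ⟨isClosed_image_sn hk, isOpen_image_sn hk⟩ ⟨_, 0, regular_ofReal hk 0, rfl⟩
  have hw : w ∈ sn k '' {t | Regular k t} := h ▸ mem_univ w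
  exact hw

/-- Solving `sn² t = 1 - w²` gives `cn t = ±w`; the reflection `t ↦ 2K - t` corrects the sign. -/
lemma exists_cn_eq (hk : k ∈ Ioo (0 : ℝ) 1) (w : ℂ) : ∃ t, Regular k t ∧ cn k t = w := by
  obtain ⟨s, hs⟩ := IsAlgClosed.exists_pow_nat_eq (1 - w ^ 2) zero_lt_two
  obtain ⟨t, ht, hts⟩ := exists_sn_eq hk s
  have h := sn_sq_add_cn_sq hk ht
  rw [hts, hs] at h
  rcases sq_eq_sq_iff_eq_or_eq_neg.1 (show cn k t ^ 2 = w ^ 2 by linear_combination h) with h | h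
  · exact ⟨t, ht, h⟩
  · exact ⟨_, (regular_two_quarterPeriod_sub hk).2 ht,
      by rw [cn_two_quarterPeriod_sub hk, h, neg_neg]⟩

end Symmetries

section Parametrization

open Complex

variable {k τ : ℝ}

/-! ### The imaginary axis -/

lemma regular_mul_I (hk : k ∈ Ioo (0 : ℝ) 1) (hτ : τ ∈ Ioo 0 (quarterPeriod (coModulus k))) :
    Regular k (τ * I) := by
  have h := (cnR_pos (coModulus_mem_Ioo hk) hτ).ne'
  by_contra hnot
  exact h (by simpa using ((not_regular_iff hk _).1 hnot).2)

lemma jacobiDen_mul_I (hk : k ∈ Ioo (0 : ℝ) 1) (τ : ℝ) :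
    jacobiDen k (τ * I) = cnR (coModulus k) τ ^ 2 := by
  simp [jacobiDen, snR_zero hk]

lemma sn_mul_I (hk : k ∈ Ioo (0 : ℝ) 1) (hτ : τ ∈ Ioo 0 (quarterPeriod (coModulus k))) :
    sn k (τ * I) = I * (snR (coModulus k) τ / cnR (coModulus k) τ : ℝ) := by
  have h : (cnR (coModulus k) τ : ℂ) ≠ 0 := by
    exact_mod_cast (cnR_pos (coModulus_mem_Ioo hk) hτ).ne'
  rw [sn, jacobiDen_mul_I hk]
  simp [snR_zero hk, cnR_zero hk, dnR_zero hk]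
  field_simp

lemma cn_mul_I (hk : k ∈ Ioo (0 : ℝ) 1) (hτ : τ ∈ Ioo 0 (quarterPeriod (coModulus k))) :
    cn k (τ * I) = (1 / cnR (coModulus k) τ : ℝ) := by
  have h : (cnR (coModulus k) τ : ℂ) ≠ 0 := by
    exact_mod_cast (cnR_pos (coModulus_mem_Ioo hk) hτ).ne'
  rw [cn, jacobiDen_mul_I hk]
  simp [snR_zero hk, cnR_zero hk]
  field_simp

lemma dn_mul_I (hk : k ∈ Ioo (0 : ℝ) 1) (hτ : τ ∈ Ioo 0 (quarterPeriod (coModulus k))) :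
    dn k (τ * I) = (dnR (coModulus k) τ / cnR (coModulus k) τ : ℝ) := by
  have h : (cnR (coModulus k) τ : ℂ) ≠ 0 := by
    exact_mod_cast (cnR_pos (coModulus_mem_Ioo hk) hτ).ne'
  rw [dn, jacobiDen_mul_I hk]
  simp [snR_zero hk, dnR_zero hk]
  field_simp

lemma exists_snR_eq (hk : k ∈ Ioo (0 : ℝ) 1) {s : ℝ} (hs : s ∈ Ioo (0 : ℝ) 1) :
    ∃ x ∈ Ioo 0 (quarterPeriod k), snR k x = s := by
  refine ⟨ellipticF k (Real.arcsin s), ⟨?_, ?_⟩, ?_⟩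
  · simpa using strictMono_ellipticF hk (Real.arcsin_pos.2 hs.1)
  · exact strictMono_ellipticF hk (Real.arcsin_lt_pi_div_two.2 hs.2)
  · rw [snR, am_ellipticF hk, Real.sin_arcsin (by linarith [hs.1]) hs.2.le]

lemma injOn_snR (hk : k ∈ Ioo (0 : ℝ) 1) : InjOn (snR k) (Ioo 0 (quarterPeriod k)) := by
  have hmem {x : ℝ} (hx : x ∈ Ioo 0 (quarterPeriod k)) :
      am k x ∈ Icc (-(Real.pi / 2)) (Real.pi / 2) := by
    have h0 := strictMono_am hk hx.1
    have h1 := strictMono_am hk hx.2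
    rw [am_zero hk] at h0
    rw [am_quarterPeriod hk] at h1
    exact ⟨by linarith [Real.pi_pos], h1.le⟩
  intro x hx y hy hxy
  exact (strictMono_am hk).injective (Real.injOn_sin (hmem hx) (hmem hy) hxy)

/-- On the segment `(0, i K')` the function `dn` takes every value greater than `1` exactly
once. -/
lemma existsUnique_dn_mul_I_eq (hk : k ∈ Ioo (0 : ℝ) 1) {r : ℝ} (hr : 1 < r) :
    ∃! τ : ℝ, τ ∈ Ioo 0 (quarterPeriod (coModulus k)) ∧ dn k (τ * I) = Real.sqrt r := by
  have hk' := coModulus_mem_Ioo hk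
  have hk2 : 0 < k ^ 2 := pow_pos hk.1 2
  have hden : 0 < r - (1 - k ^ 2) := by linarith
  -- With `s = sn (τ; k')` the condition reads `(1 - (1 - k²)s²) / (1 - s²) = r`, which is linear in
  -- `s²`.
  have key {τ : ℝ} (hτ : τ ∈ Ioo 0 (quarterPeriod (coModulus k))) :
      dn k (τ * I) = Real.sqrt r ↔
        snR (coModulus k) τ = Real.sqrt ((r - 1) / (r - (1 - k ^ 2))) := by
    have hs := snR_pos hk' hτ
    have hc := cnR_pos hk' hτ
    have hd := dnR_pos hk' τ
    have h1 := eq_sub_of_add_eq' (snR_sq_add_cnR_sq (coModulus k) τ)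
    have h2 := dnR_sq hk' τ
    rw [coModulus_sq hk] at h2
    rw [dn_mul_I hk hτ, ofReal_inj, eq_comm, Real.sqrt_eq_iff_mul_self_eq_of_pos (by positivity),
      eq_comm (b := Real.sqrt _), Real.sqrt_eq_iff_mul_self_eq_of_pos hs, eq_div_iff hden.ne',
      ← sq, ← sq, div_pow, div_eq_iff (by positivity), h1, h2]
    constructor <;> intro h <;> linear_combination h
  have hmem : Real.sqrt ((r - 1) / (r - (1 - k ^ 2))) ∈ Ioo (0 : ℝ) 1 := by
    refine ⟨Real.sqrt_pos.2 (div_pos (by linarith) hden), ?_⟩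
    rw [Real.sqrt_lt' one_pos, one_pow, div_lt_one hden]
    linarith
  obtain ⟨τ, hτ, hs⟩ := exists_snR_eq hk' hmem
  refine ⟨τ, ⟨hτ, (key hτ).2 hs⟩, ?_⟩
  rintro τ' ⟨hτ', hd'⟩
  exact injOn_snR hk' hτ' hτ (((key hτ').1 hd').trans hs.symm)

/-! ### Shifts by an imaginary number -/

/-- If the denominator of the addition theorem does not vanish, then `t + i τ` is not a pole. -/
lemma regular_add_mul_I (hk : k ∈ Ioo (0 : ℝ) 1)
    (hτ : τ ∈ Ioo 0 (quarterPeriod (coModulus k))) {t : ℂ} (ht : Regular k t)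
    (h : 1 - k ^ 2 * sn k t ^ 2 * sn k (τ * I) ^ 2 ≠ 0) : Regular k (t + τ * I) := by
  have hk' := coModulus_mem_Ioo hk
  by_contra hnot
  obtain ⟨h1, h2⟩ := (not_regular_iff hk _).1 hnot
  have hre : (t + τ * I).re = t.re := by simp
  have him : (t + τ * I).im = t.im + τ := by simp
  rw [hre] at h1
  rw [him] at h2
  have hc : cnR (coModulus k) t.im ≠ 0 := fun hc => (not_regular_iff hk t).2 ⟨h1, hc⟩ ht
  have hcτ := (cnR_pos hk' hτ).ne'
  have hadd := cnR_add hk' t.im τ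
  rw [h2, zero_mul] at hadd
  have hc1 := snR_sq_add_cnR_sq k t.re
  have hd1 := dnR_sq hk t.re
  rw [h1] at hc1 hd1
  -- Since `sn (t.re) = 0`, the factors `cn (t.re)` and `dn (t.re)` have square `1`, and `sn t` is,
  -- up to sign, its value at `i t.im`.
  have hsn : sn k t = I * (cnR k t.re * dnR k t.re * snR (coModulus k) t.im
      / cnR (coModulus k) t.im : ℝ) := by
    have hc' : (cnR (coModulus k) t.im : ℂ) ≠ 0 := by exact_mod_cast hc
    rw [sn, jacobiDen, h1]
    simp
    field_simp
  have e1 := eq_sub_of_add_eq' (snR_sq_add_cnR_sq (coModulus k) t.im)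
  have e2 := eq_sub_of_add_eq' (snR_sq_add_cnR_sq (coModulus k) τ)
  have e3 := dnR_sq hk' t.im
  have e4 := dnR_sq hk' τ
  have hpos := one_sub_sq_mul_snR_sq_mul_snR_sq_pos hk' t.im τ
  rw [coModulus_sq hk] at e3 e4 hpos
  refine h ?_
  rw [hsn, sn_mul_I hk hτ, mul_pow, mul_pow, I_sq]
  simp only [mul_neg, neg_mul, neg_neg]
  norm_cast
  rw [div_pow, div_pow, mul_pow, mul_pow, show cnR k t.re ^ 2 = 1 by linarith,
    show dnR k t.re ^ 2 = 1 by linarith]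
  have hsq : (cnR (coModulus k) t.im * cnR (coModulus k) τ) ^ 2
      = (snR (coModulus k) t.im * snR (coModulus k) τ * dnR (coModulus k) t.im
        * dnR (coModulus k) τ) ^ 2 := by
    rw [sub_eq_zero.1 hadd.symm]
  simp only [mul_pow, e1, e2, e3, e4] at hsq
  -- With `S`, `T` the two values of `sn` and `m = 1 - k²`, the squared relation factors as `(1 -
  -- mS²T²)(1 + mS²T² - S² - T²) = 0`, and the first factor is positive.
  have hsum : snR (coModulus k) t.im ^ 2 + snR (coModulus k) τ ^ 2
      = 1 + (1 - k ^ 2) * snR (coModulus k) t.im ^ 2 * snR (coModulus k) τ ^ 2 := by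
    refine mul_left_cancel₀ hpos.ne' ?_
    linear_combination -hsq
  have hprod : cnR (coModulus k) t.im ^ 2 * cnR (coModulus k) τ ^ 2
      = k ^ 2 * (snR (coModulus k) t.im ^ 2 * snR (coModulus k) τ ^ 2) := by
    rw [e1, e2]
    linear_combination -hsum
  field_simp
  linear_combination hprod

lemma regular_sub_mul_I (hk : k ∈ Ioo (0 : ℝ) 1)
    (hτ : τ ∈ Ioo 0 (quarterPeriod (coModulus k))) {t : ℂ} (ht : Regular k t)
    (h : 1 - k ^ 2 * sn k t ^ 2 * sn k (τ * I) ^ 2 ≠ 0) : Regular k (t - τ * I) := by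
  rw [← regular_neg hk, neg_sub, sub_eq_neg_add]
  exact regular_add_mul_I hk hτ ((regular_neg hk).2 ht) (by rwa [sn_neg hk, neg_sq])

/-- `t - i τ` and `t + i τ` are not both poles. -/
lemma regular_sub_or_regular_add (hk : k ∈ Ioo (0 : ℝ) 1)
    (hτ : τ ∈ Ioo 0 (quarterPeriod (coModulus k))) (t : ℂ) :
    Regular k (t - τ * I) ∨ Regular k (t + τ * I) := by
  have hk' := coModulus_mem_Ioo hk
  by_contra! hnot
  have h1 := ((not_regular_iff hk _).1 hnot.1).2
  have h2 := ((not_regular_iff hk _).1 hnot.2).2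
  rw [show (t - τ * I).im = t.im + -τ by simp [sub_eq_add_neg]] at h1
  rw [show (t + τ * I).im = t.im + τ by simp] at h2
  have hadd := cnR_add hk' t.im τ
  have hsub := cnR_add hk' t.im (-τ)
  rw [h2, zero_mul] at hadd
  rw [h1, zero_mul, snR_neg hk', cnR_neg hk', dnR_neg hk'] at hsub
  -- The sum and the difference of the two addition formulas force `cn` and `sn` of modulus `k'` to
  -- vanish together at `t.im`.
  have hcc : cnR (coModulus k) t.im * cnR (coModulus k) τ = 0 := by linarith
  have hss : snR (coModulus k) t.im * (snR (coModulus k) τ * (dnR (coModulus k) t.im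
      * dnR (coModulus k) τ)) = 0 := by linarith
  have hc := (mul_eq_zero_iff_right (cnR_pos hk' hτ).ne').1 hcc
  have hs := (mul_eq_zero_iff_right (mul_pos (snR_pos hk' hτ)
    (mul_pos (dnR_pos hk' t.im) (dnR_pos hk' τ))).ne').1 hss
  have h := snR_sq_add_cnR_sq (coModulus k) t.im
  rw [hc, hs] at h
  norm_num at h

lemma cn_mul_I_ne_zero (hk : k ∈ Ioo (0 : ℝ) 1)
    (hτ : τ ∈ Ioo 0 (quarterPeriod (coModulus k))) : cn k (τ * I) ≠ 0 := by
  rw [cn_mul_I hk hτ, ofReal_ne_zero]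
  exact (one_div_pos.2 (cnR_pos (coModulus_mem_Ioo hk) hτ)).ne'

lemma dn_mul_I_ne_zero (hk : k ∈ Ioo (0 : ℝ) 1)
    (hτ : τ ∈ Ioo 0 (quarterPeriod (coModulus k))) : dn k (τ * I) ≠ 0 := by
  rw [dn_mul_I hk hτ, ofReal_ne_zero]
  exact (div_pos (dnR_pos (coModulus_mem_Ioo hk) τ) (cnR_pos (coModulus_mem_Ioo hk) hτ)).ne'

lemma sn_biquadratic_sub (hk : k ∈ Ioo (0 : ℝ) 1) {t θ : ℂ} (ht : Regular k t) (hθ : Regular k θ)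
    (htθ : Regular k (t - θ)) :
    (1 - k ^ 2 * sn k t ^ 2 * sn k θ ^ 2) * sn k (t - θ) ^ 2
      - 2 * cn k θ * dn k θ * sn k t * sn k (t - θ) + sn k t ^ 2 - sn k θ ^ 2 = 0 := by
  have h := sn_biquadratic hk ht ((regular_neg hk).2 hθ) (by rwa [← sub_eq_add_neg])
  rwa [sn_neg hk, cn_neg hk, dn_neg hk, neg_sq, ← sub_eq_add_neg] at h

lemma cn_biquadratic_sub (hk : k ∈ Ioo (0 : ℝ) 1) {t θ : ℂ} (ht : Regular k t) (hθ : Regular k θ)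
    (htθ : Regular k (t - θ)) :
    (1 - k ^ 2 * sn k t ^ 2 * sn k θ ^ 2) * cn k (t - θ) ^ 2
      - 2 * cn k θ * cn k t * cn k (t - θ) + dn k θ ^ 2 * cn k t ^ 2
      + (k ^ 2 - 1) * sn k θ ^ 2 = 0 := by
  have h := cn_biquadratic hk ht ((regular_neg hk).2 hθ) (by rwa [← sub_eq_add_neg])
  rwa [sn_neg hk, cn_neg hk, dn_neg hk, neg_sq, ← sub_eq_add_neg] at h

/-- Vieta's formula for the biquadratic read as a quadratic in its second variable: it identifies
the value at `t + θ` as the other root, also when the two roots coincide. -/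
lemma sn_add_add_sn_sub (hk : k ∈ Ioo (0 : ℝ) 1) {t θ : ℂ} (ht : Regular k t) (hθ : Regular k θ)
    (hadd : Regular k (t + θ)) (hsub : Regular k (t - θ)) :
    (1 - k ^ 2 * sn k t ^ 2 * sn k θ ^ 2) * (sn k (t - θ) + sn k (t + θ))
      = 2 * cn k θ * dn k θ * sn k t := by
  have h1 := sn_add hk ht hθ hadd
  have h2 := sn_add hk ht ((regular_neg hk).2 hθ) (by rwa [← sub_eq_add_neg])
  rw [sn_neg hk, cn_neg hk, dn_neg hk, neg_sq, ← sub_eq_add_neg] at h2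
  linear_combination h1 + h2

lemma cn_add_add_cn_sub (hk : k ∈ Ioo (0 : ℝ) 1) {t θ : ℂ} (ht : Regular k t) (hθ : Regular k θ)
    (hadd : Regular k (t + θ)) (hsub : Regular k (t - θ)) :
    (1 - k ^ 2 * sn k t ^ 2 * sn k θ ^ 2) * (cn k (t - θ) + cn k (t + θ))
      = 2 * cn k θ * cn k t := by
  have h1 := cn_add hk ht hθ hadd
  have h2 := cn_add hk ht ((regular_neg hk).2 hθ) (by rwa [← sub_eq_add_neg])
  rw [sn_neg hk, cn_neg hk, dn_neg hk, neg_sq, ← sub_eq_add_neg] at h2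
  linear_combination h1 + h2

/-! ### Parametrization of the normal forms -/

/-- If `y₁` is a root of `A y² - 2 B y + C`, then a second root is the other one. -/
lemma eq_or_eq_of_quadratic {A B C y y₁ y₂ : ℂ} (hA : A ≠ 0) (h : A * y ^ 2 - B * y + C = 0)
    (h₁ : A * y₁ ^ 2 - B * y₁ + C = 0) (hsum : A * (y₁ + y₂) = B) : y = y₁ ∨ y = y₂ := by
  have h0 : A * ((y - y₁) * (y - y₂)) = 0 := by
    linear_combination h - h₁ - (y - y₁) * hsum
  simpa [hA, sub_eq_zero] using h0

/-- For `t` with `sn t = x`, the roots `y` are `sn (t - θ)` and `sn (t + θ)`. The second is brought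
to the required form by `t ↦ 2K - t`, which preserves `sn`. -/
lemma exists_sn_of_biquadratic (hk : k ∈ Ioo (0 : ℝ) 1)
    (hτ : τ ∈ Ioo 0 (quarterPeriod (coModulus k))) {θ : ℂ} (hθ : θ = τ * I) {x y : ℂ}
    (h : (1 - k ^ 2 * x ^ 2 * sn k θ ^ 2) * y ^ 2 - 2 * cn k θ * dn k θ * x * y + x ^ 2
      - sn k θ ^ 2 = 0) :
    ∃ t ∈ regularSet k (-θ), x = sn k t ∧ y = sn k (t - θ) := by
  subst hθ
  have hθ := regular_mul_I hk hτ
  obtain ⟨t, ht, rfl⟩ := exists_sn_eq hk x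
  have hrefl (ht' : Regular k (t + τ * I)) (hy : y = sn k (t + τ * I)) :
      ∃ u ∈ regularSet k (-(τ * I)), sn k t = sn k u ∧ y = sn k (u - τ * I) := by
    have e : 2 * quarterPeriod k - t - τ * I = 2 * quarterPeriod k - (t + τ * I) := by ring
    refine ⟨2 * quarterPeriod k - t, ⟨(regular_two_quarterPeriod_sub hk).2 ht, ?_⟩,
      (sn_two_quarterPeriod_sub hk t).symm, ?_⟩
    · rw [← sub_eq_add_neg, e]
      exact (regular_two_quarterPeriod_sub hk).2 ht'
    · rw [e, sn_two_quarterPeriod_sub hk, hy]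
  have hdir (ht' : Regular k (t - τ * I)) (hy : y = sn k (t - τ * I)) :
      ∃ u ∈ regularSet k (-(τ * I)), sn k t = sn k u ∧ y = sn k (u - τ * I) :=
    ⟨t, ⟨ht, by rwa [← sub_eq_add_neg]⟩, rfl, hy⟩
  -- When the leading coefficient vanishes, the equation is linear in `y` with nonzero slope, so any
  -- regular shift gives its only root. Otherwise both shifts are regular.
  by_cases hΔ : 1 - k ^ 2 * sn k t ^ 2 * sn k (τ * I) ^ 2 = 0
  · have hsn : sn k t ≠ 0 := fun h0 => by simp [h0] at hΔ
    have hB : 2 * cn k (τ * I) * dn k (τ * I) * sn k t ≠ 0 :=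
      mul_ne_zero (mul_ne_zero (mul_ne_zero two_ne_zero (cn_mul_I_ne_zero hk hτ))
        (dn_mul_I_ne_zero hk hτ)) hsn
    rcases regular_sub_or_regular_add hk hτ t with hr | hr
    · refine hdir hr (mul_left_cancel₀ hB ?_)
      linear_combination sn_biquadratic_sub hk ht hθ hr - h
        + (y ^ 2 - sn k (t - τ * I) ^ 2) * hΔ
    · refine hrefl hr (mul_left_cancel₀ hB ?_)
      linear_combination sn_biquadratic hk ht hθ hr - h
        + (y ^ 2 - sn k (t + τ * I) ^ 2) * hΔ
  · have hr1 := regular_sub_mul_I hk hτ ht hΔ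
    have hr2 := regular_add_mul_I hk hτ ht hΔ
    rcases eq_or_eq_of_quadratic (y := y) (C := sn k t ^ 2 - sn k (τ * I) ^ 2) hΔ
      (by linear_combination h) (by linear_combination sn_biquadratic_sub hk ht hθ hr1)
      (sn_add_add_sn_sub hk ht hθ hr2 hr1) with hy | hy
    · exact hdir hr1 hy
    · exact hrefl hr2 hy

/-- As for `sn`, except that the two roots are exchanged by `t ↦ -t`, because `cn` is even. -/
lemma exists_cn_of_biquadratic (hk : k ∈ Ioo (0 : ℝ) 1)
    (hτ : τ ∈ Ioo 0 (quarterPeriod (coModulus k))) {θ : ℂ} (hθ : θ = τ * I) {x y : ℂ}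
    (h : (k ^ 2 * sn k θ ^ 2 * x ^ 2 + dn k θ ^ 2) * y ^ 2 - 2 * cn k θ * x * y
      + dn k θ ^ 2 * x ^ 2 + (k ^ 2 - 1) * sn k θ ^ 2 = 0) :
    ∃ t ∈ regularSet k (-θ), x = cn k t ∧ y = cn k (t - θ) := by
  subst hθ
  have hθ := regular_mul_I hk hτ
  obtain ⟨t, ht, rfl⟩ := exists_cn_eq hk x
  have hdn := dn_sq hk hθ
  have hsc := sn_sq_add_cn_sq hk ht
  replace h : (1 - k ^ 2 * sn k t ^ 2 * sn k (τ * I) ^ 2) * y ^ 2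
      - 2 * cn k (τ * I) * cn k t * y + dn k (τ * I) ^ 2 * cn k t ^ 2
      + (k ^ 2 - 1) * sn k (τ * I) ^ 2 = 0 := by
    linear_combination h - y ^ 2 * hdn - k ^ 2 * sn k (τ * I) ^ 2 * y ^ 2 * hsc
  have hrefl (ht' : Regular k (t + τ * I)) (hy : y = cn k (t + τ * I)) :
      ∃ u ∈ regularSet k (-(τ * I)), cn k t = cn k u ∧ y = cn k (u - τ * I) := by
    refine ⟨-t, ⟨(regular_neg hk).2 ht, ?_⟩, (cn_neg hk t).symm, ?_⟩
    · rw [← neg_add]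
      exact (regular_neg hk).2 ht'
    · rw [← neg_add', cn_neg hk, hy]
  have hdir (ht' : Regular k (t - τ * I)) (hy : y = cn k (t - τ * I)) :
      ∃ u ∈ regularSet k (-(τ * I)), cn k t = cn k u ∧ y = cn k (u - τ * I) :=
    ⟨t, ⟨ht, by rwa [← sub_eq_add_neg]⟩, rfl, hy⟩
  by_cases hΔ : 1 - k ^ 2 * sn k t ^ 2 * sn k (τ * I) ^ 2 = 0
  -- If `cn t = 0`, then `sn² t = 1` and the leading coefficient is `dn² θ ≠ 0`.
  · have hcn : cn k t ≠ 0 := fun h0 => by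
      rw [h0] at hsc
      refine dn_mul_I_ne_zero hk hτ (sq_eq_zero_iff.1 ?_)
      linear_combination hdn + hΔ + k ^ 2 * sn k (τ * I) ^ 2 * hsc
    have hB : 2 * cn k (τ * I) * cn k t ≠ 0 :=
      mul_ne_zero (mul_ne_zero two_ne_zero (cn_mul_I_ne_zero hk hτ)) hcn
    rcases regular_sub_or_regular_add hk hτ t with hr | hr
    · refine hdir hr (mul_left_cancel₀ hB ?_)
      linear_combination cn_biquadratic_sub hk ht hθ hr - h
        + (y ^ 2 - cn k (t - τ * I) ^ 2) * hΔ
    · refine hrefl hr (mul_left_cancel₀ hB ?_)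
      linear_combination cn_biquadratic hk ht hθ hr - h
        + (y ^ 2 - cn k (t + τ * I) ^ 2) * hΔ
  · have hr1 := regular_sub_mul_I hk hτ ht hΔ
    have hr2 := regular_add_mul_I hk hτ ht hΔ
    rcases eq_or_eq_of_quadratic (y := y) (C := dn k (τ * I) ^ 2 * cn k t ^ 2
        + (k ^ 2 - 1) * sn k (τ * I) ^ 2) hΔ
      (by linear_combination h) (by linear_combination cn_biquadratic_sub hk ht hθ hr1)
      (cn_add_add_cn_sub hk ht hθ hr2 hr1) with hy | hy
    · exact hdir hr1 hy
    · exact hrefl hr2 hy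

/-! ### The shift by the quarter period. -/

lemma sn_quarterPeriod (hk : k ∈ Ioo (0 : ℝ) 1) : sn k (quarterPeriod k) = 1 := by
  simp [sn_ofReal hk, snR_quarterPeriod hk]

lemma cn_quarterPeriod (hk : k ∈ Ioo (0 : ℝ) 1) : cn k (quarterPeriod k) = 0 := by
  simp [cn_ofReal hk, cnR_quarterPeriod hk]

lemma dn_quarterPeriod_sq (hk : k ∈ Ioo (0 : ℝ) 1) : dn k (quarterPeriod k) ^ 2 = 1 - k ^ 2 := by
  simp [dn_sq hk (regular_ofReal hk _), sn_quarterPeriod hk]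

lemma sn_opposite (hk : k ∈ Ioo (0 : ℝ) 1) {t : ℂ} (ht : t ∈ regularSet k (quarterPeriod k)) :
    (1 - k ^ 2 * sn k t ^ 2) * sn k (t + quarterPeriod k) ^ 2 + sn k t ^ 2 - 1 = 0 := by
  have h := sn_biquadratic hk ht.1 (regular_ofReal hk _) ht.2
  rw [sn_quarterPeriod hk, cn_quarterPeriod hk] at h
  linear_combination h

lemma cn_opposite (hk : k ∈ Ioo (0 : ℝ) 1) {t : ℂ} (ht : t ∈ regularSet k (quarterPeriod k)) :
    (k ^ 2 * cn k t ^ 2 + (1 - k ^ 2)) * cn k (t + quarterPeriod k) ^ 2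
      + (1 - k ^ 2) * (cn k t ^ 2 - 1) = 0 := by
  have h := cn_biquadratic hk ht.1 (regular_ofReal hk _) ht.2
  rw [sn_quarterPeriod hk, cn_quarterPeriod hk, dn_quarterPeriod_sq hk] at h
  linear_combination h
    + k ^ 2 * cn k (t + quarterPeriod k) ^ 2 * sn_sq_add_cn_sq hk ht.1

/-- If `t + K` is a pole, then `cn (t.re; k) = 0` and `cn (t.im; k') = 0`, and both terms in the
numerator of `dn t` vanish. -/
lemma regular_add_quarterPeriod (hk : k ∈ Ioo (0 : ℝ) 1) {t : ℂ} (hdn : dn k t ≠ 0) :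
    Regular k (t + quarterPeriod k) := by
  by_contra hnot
  obtain ⟨h1, h2⟩ := (not_regular_iff hk _).1 hnot
  rw [show (t + quarterPeriod k).re = t.re + quarterPeriod k by simp] at h1
  rw [show (t + quarterPeriod k).im = t.im by simp] at h2
  have h := snR_add hk t.re (quarterPeriod k)
  rw [h1, cnR_quarterPeriod hk, snR_quarterPeriod hk] at h
  have hc : cnR k t.re = 0 := by
    have := (dnR_pos hk t.re).ne'
    simpa [this] using h
  exact hdn (by simp [dn, hc, h2])

/-- The equation determines `z` up to sign, and `t ↦ 2K - t` preserves `sn t` while negating `sn (t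
+ K)`. -/
lemma exists_sn_of_opposite (hk : k ∈ Ioo (0 : ℝ) 1) {x z : ℂ}
    (h : (1 - k ^ 2 * x ^ 2) * z ^ 2 + x ^ 2 - 1 = 0) :
    ∃ t ∈ regularSet k (quarterPeriod k), x = sn k t ∧ z = sn k (t + quarterPeriod k) := by
  obtain ⟨t, ht, rfl⟩ := exists_sn_eq hk x
  have hk2 : (1 - k ^ 2 : ℂ) ≠ 0 := by
    exact_mod_cast (sub_pos.2 (show k ^ 2 < 1 by nlinarith [hk.1, hk.2])).ne'
  -- A vanishing leading coefficient would force `x² = 1`, hence `k² = 1`.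
  have hΔ : 1 - k ^ 2 * sn k t ^ 2 ≠ 0 := fun h0 => hk2 (by
    linear_combination k ^ 2 * h - k ^ 2 * z ^ 2 * h0 + h0)
  have hdn : dn k t ≠ 0 := fun h0 => hΔ (by rw [← dn_sq hk ht, h0]; ring)
  have hr := regular_add_quarterPeriod hk hdn
  have hz : z ^ 2 = sn k (t + quarterPeriod k) ^ 2 :=
    mul_left_cancel₀ hΔ (by linear_combination h - sn_opposite hk ⟨ht, hr⟩)
  rcases sq_eq_sq_iff_eq_or_eq_neg.1 hz with hz | hz
  · exact ⟨t, ⟨ht, hr⟩, rfl, hz⟩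
  · have e : 2 * quarterPeriod k - t + quarterPeriod k
        = -(t + quarterPeriod k) + 2 * quarterPeriod k + 2 * quarterPeriod k := by ring
    refine ⟨2 * quarterPeriod k - t, ⟨(regular_two_quarterPeriod_sub hk).2 ht, ?_⟩,
      (sn_two_quarterPeriod_sub hk t).symm, ?_⟩
    · rw [e, regular_add_two_quarterPeriod hk, regular_add_two_quarterPeriod hk, regular_neg hk]
      exact hr
    · rw [e, sn_add_two_quarterPeriod hk, sn_add_two_quarterPeriod hk, sn_neg hk, hz, neg_neg]

/-- The sign of `z` is adjusted by `t ↦ -t`, which preserves `cn t` and negates `cn (t + K)`. A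
vanishing leading coefficient would force `x² = 1`, where that coefficient is `1`. -/
lemma exists_cn_of_opposite (hk : k ∈ Ioo (0 : ℝ) 1) {x z : ℂ}
    (h : (k ^ 2 * x ^ 2 + (1 - k ^ 2)) * z ^ 2 + (1 - k ^ 2) * (x ^ 2 - 1) = 0) :
    ∃ t ∈ regularSet k (quarterPeriod k), x = cn k t ∧ z = cn k (t + quarterPeriod k) := by
  obtain ⟨t, ht, rfl⟩ := exists_cn_eq hk x
  have hk2 : (1 - k ^ 2 : ℂ) ≠ 0 := by
    exact_mod_cast (sub_pos.2 (show k ^ 2 < 1 by nlinarith [hk.1, hk.2])).ne'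
  have hΔ : k ^ 2 * cn k t ^ 2 + (1 - k ^ 2) ≠ 0 := fun h0 => hk2 (by
    have hx : cn k t ^ 2 = 1 := by
      refine sub_eq_zero.1 ((mul_eq_zero_iff_left hk2).1 ?_)
      linear_combination h - z ^ 2 * h0
    exfalso
    rw [hx] at h0
    exact one_ne_zero (by linear_combination h0))
  have hdn : dn k t ≠ 0 := fun h0 => hΔ (by
    linear_combination dn k t * h0 - dn_sq hk ht + k ^ 2 * sn_sq_add_cn_sq hk ht)
  have hr := regular_add_quarterPeriod hk hdn
  have hz : z ^ 2 = cn k (t + quarterPeriod k) ^ 2 :=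
    mul_left_cancel₀ hΔ (by linear_combination h - cn_opposite hk ⟨ht, hr⟩)
  rcases sq_eq_sq_iff_eq_or_eq_neg.1 hz with hz | hz
  · exact ⟨t, ⟨ht, hr⟩, rfl, hz⟩
  · have e : -t + quarterPeriod k = -(t + quarterPeriod k) + 2 * quarterPeriod k := by ring
    refine ⟨-t, ⟨(regular_neg hk).2 ht, ?_⟩, (cn_neg hk t).symm, ?_⟩
    · rw [e, regular_add_two_quarterPeriod hk, regular_neg hk]
      exact hr
    · rw [e, cn_add_two_quarterPeriod hk, cn_neg hk, hz]

end Parametrization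

section Linkage

open Complex

/-! ### The normal forms -/

lemma ParametrizedBy.of_iff {R N : ℂ → ℂ → Prop} {S : Set ℂ} {φ ψ : ℂ → ℂ} {p q : ℂ} (hp : p ≠ 0)
    (hq : q ≠ 0) (h : ∀ X Y, R (p * X) (q * Y) ↔ N X Y) (hN : ParametrizedBy N S φ ψ) :
    ParametrizedBy R S (fun t => p * φ t) (fun t => q * ψ t) := by
  intro x y
  have hx : x = p * (x / p) := by field_simp
  have hy : y = q * (y / q) := by field_simp
  rw [hx, hy, h, hN]
  simp only [mul_right_inj' hp, mul_right_inj' hq]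

variable {k M : ℝ}

lemma sqrt_one_sub_one_div_mem_Ioo (hM : 1 < M) (hk : k = Real.sqrt (1 - 1 / M)) :
    k ∈ Ioo (0 : ℝ) 1 ∧ k ^ 2 = 1 - 1 / M := by
  have h0 : 0 < 1 / M := by positivity
  have h1 : 1 / M < 1 := (div_lt_one (by linarith)).2 hM
  rw [hk]
  refine ⟨⟨Real.sqrt_pos.2 (by linarith), ?_⟩, Real.sq_sqrt (by linarith)⟩
  rw [Real.sqrt_lt' one_pos]
  linarith

lemma sqrt_one_sub_mem_Ioo (hM0 : 0 < M) (hM : M < 1) (hk : k = Real.sqrt (1 - M)) :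
    k ∈ Ioo (0 : ℝ) 1 ∧ k ^ 2 = 1 - M := by
  rw [hk]
  refine ⟨⟨Real.sqrt_pos.2 (by linarith), ?_⟩, Real.sq_sqrt (by linarith)⟩
  rw [Real.sqrt_lt' one_pos]
  linarith

/-- Since `Mk² = M - 1`, the normal form is `M` times the relation `cn_opposite`. -/
lemma parametrizedBy_opposite_cn (hM : 1 < M) (hk : k = Real.sqrt (1 - 1 / M)) :
    ParametrizedBy (fun X Z => (M - 1) * X ^ 2 * Z ^ 2 + X ^ 2 + Z ^ 2 - 1 = 0)
      (regularSet k (quarterPeriod k)) (cn k) (fun t => cn k (t + quarterPeriod k)) := by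
  obtain ⟨hk, hk2⟩ := sqrt_one_sub_one_div_mem_Ioo hM hk
  have hM0 : (M : ℂ) ≠ 0 := by exact_mod_cast (one_pos.trans hM).ne'
  have hkM : (M : ℂ) * k ^ 2 = M - 1 := by
    rw [← ofReal_pow, hk2]
    push_cast
    field_simp
  intro X Z
  constructor
  · intro h
    refine exists_cn_of_opposite hk (mul_left_cancel₀ hM0 ?_)
    linear_combination h + (X ^ 2 * Z ^ 2 - Z ^ 2 - (X ^ 2 - 1)) * hkM
  · rintro ⟨t, ht, rfl, rfl⟩
    linear_combination M * cn_opposite hk ht - (cn k t ^ 2 * cn k (t + quarterPeriod k) ^ 2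
      - cn k (t + quarterPeriod k) ^ 2 - (cn k t ^ 2 - 1)) * hkM

lemma parametrizedBy_opposite_sn (hM0 : 0 < M) (hM : M < 1) (hk : k = Real.sqrt (1 - M)) :
    ParametrizedBy (fun X Z => (M - 1) * X ^ 2 * Z ^ 2 + X ^ 2 + Z ^ 2 - 1 = 0)
      (regularSet k (quarterPeriod k)) (sn k) (fun t => sn k (t + quarterPeriod k)) := by
  obtain ⟨hk, hk2⟩ := sqrt_one_sub_mem_Ioo hM0 hM hk
  have hkM : (k : ℂ) ^ 2 = 1 - M := by exact_mod_cast hk2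
  intro X Z
  constructor
  · intro h
    refine exists_sn_of_opposite hk ?_
    linear_combination h - X ^ 2 * Z ^ 2 * hkM
  · rintro ⟨t, ht, rfl, rfl⟩
    linear_combination sn_opposite hk ht + sn k t ^ 2 * sn k (t + quarterPeriod k) ^ 2 * hkM

/-! ### Matching the coefficients of the adjacent normal form. -/

lemma cn_biquadratic_div (hk : k ∈ Ioo (0 : ℝ) 1) {t θ : ℂ} (ht : Regular k t) (hθ : Regular k θ)
    (htθ : Regular k (t - θ)) (hd : dn k θ ≠ 0) :
    k ^ 2 * sn k θ ^ 2 / dn k θ ^ 2 * cn k t ^ 2 * cn k (t - θ) ^ 2 + cn k t ^ 2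
      - 2 * cn k θ / dn k θ ^ 2 * cn k t * cn k (t - θ) + cn k (t - θ) ^ 2
      + (k ^ 2 - 1) * sn k θ ^ 2 / dn k θ ^ 2 = 0 := by
  have h := cn_biquadratic_sub hk ht hθ htθ
  field_simp
  linear_combination h + cn k (t - θ) ^ 2 * dn_sq hk hθ
    + k ^ 2 * sn k θ ^ 2 * cn k (t - θ) ^ 2 * sn_sq_add_cn_sq hk ht

/-- The adjacent relation in the case of the functions `cn`, for a curve with given normal form. -/
lemma adjacent_cn (hM : 1 < M) (hk : k = Real.sqrt (1 - 1 / M)) {r A₁ A₂ A₃ : ℝ} {A : ℂ}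
    (hr : 1 < r) (h₁ : A₁ = 1 / r - 1) (hA : A = A₂) (hpos : 0 < A₂)
    (h₂ : A₂ ^ 2 = (r * M - 1) / ((M - 1) * r ^ 2)) (h₃ : A₃ = (1 - 1 / r) / (M - 1))
    {R R' : ℂ → ℂ → Prop} {p q q' : ℂ} (hp : p ≠ 0) (hq : q ≠ 0) (hq' : q' ≠ 0)
    (hR : ∀ X Y, R (p * X) (q * Y) ↔
      A₁ * X ^ 2 * Y ^ 2 + X ^ 2 - 2 * A * X * Y + Y ^ 2 + A₃ = 0)
    (hR' : ∀ X Y, R' (p * X) (q' * Y) ↔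
      A₁ * X ^ 2 * Y ^ 2 + X ^ 2 - 2 * A * X * Y + Y ^ 2 + A₃ = 0) :
    (∃! τ : ℝ, τ ∈ Ioo 0 (quarterPeriod (coModulus k)) ∧ dn k (τ * I) = Real.sqrt r) ∧
    ∀ τ ∈ Ioo 0 (quarterPeriod (coModulus k)), ∀ θ : ℂ, θ = τ * I →
      ((k ^ 2 * sn k θ ^ 2 / dn k θ ^ 2 = A₁ ∧ cn k θ / dn k θ ^ 2 = A ∧
        (k ^ 2 - 1) * sn k θ ^ 2 / dn k θ ^ 2 = A₃) ↔ dn k θ = Real.sqrt r) ∧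
      (dn k θ = Real.sqrt r →
        ParametrizedBy R (regularSet k (-θ)) (fun t => p * cn k t) (fun t => q * cn k (t - θ)) ∧
        ParametrizedBy R' (regularSet k (-θ)) (fun t => p * cn k t)
          (fun t => q' * cn k (t - θ))) := by
  obtain ⟨hk, hk2⟩ := sqrt_one_sub_one_div_mem_Ioo hM hk
  refine ⟨existsUnique_dn_mul_I_eq hk hr, fun τ hτ θ hθ => ?_⟩
  have hreg : Regular k θ := hθ ▸ regular_mul_I hk hτ
  have hd0 : dn k θ ≠ 0 := hθ ▸ dn_mul_I_ne_zero hk hτ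
  have hdn := dn_sq hk hreg
  have hsc := sn_sq_add_cn_sq hk hreg
  have hM0 : M ≠ 0 := by linarith
  have hM1 : M - 1 ≠ 0 := by linarith
  have hr0 : r ≠ 0 := by linarith
  have hkM : (M : ℂ) * k ^ 2 = M - 1 := by
    rw [← ofReal_pow, hk2]
    push_cast
    have : (M : ℂ) ≠ 0 := by exact_mod_cast hM0
    field_simp
  have hsys : dn k θ = Real.sqrt r → k ^ 2 * sn k θ ^ 2 / dn k θ ^ 2 = A₁ ∧
      cn k θ / dn k θ ^ 2 = A ∧ (k ^ 2 - 1) * sn k θ ^ 2 / dn k θ ^ 2 = A₃ := by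
    intro hd
    have hd2 : dn k θ ^ 2 = r := by
      rw [hd]
      exact_mod_cast Real.sq_sqrt (by linarith : 0 ≤ r)
    have hr0' : (r : ℂ) ≠ 0 := by exact_mod_cast hr0
    have hM1' : (M - 1 : ℂ) ≠ 0 := by exact_mod_cast hM1
    -- This is `dn² θ = r` solved for `sn² θ`; every coefficient thereby becomes a function of `r`
    -- and `M`.
    have hs2 : (M - 1) * sn k θ ^ 2 = M * (1 - r) := by
      linear_combination M * hdn - M * hd2 - sn k θ ^ 2 * hkM
    rw [hd2] at hdn ⊢
    refine ⟨?_, ?_, ?_⟩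
    · rw [h₁]
      push_cast
      field_simp
      linear_combination hdn
    · have hc0 := cnR_pos (coModulus_mem_Ioo hk) hτ
      have hc : cn k θ = (1 / cnR (coModulus k) τ : ℝ) := hθ ▸ cn_mul_I hk hτ
      rw [hA, hc, ← ofReal_div, ofReal_inj]
      -- Both sides are positive because `cn (iτ) = 1 / cn (τ; k')`, so comparing squares suffices.
      refine (sq_eq_sq₀ (by positivity) hpos.le).1 ?_
      have hC : ((1 / cnR (coModulus k) τ) ^ 2) * (M - 1) = r * M - 1 := by
        have : (cn k θ) ^ 2 * (M - 1) = r * M - 1 := by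
          linear_combination (M - 1) * hsc - hs2
        rw [hc] at this
        exact_mod_cast this
      rw [h₂, div_pow, div_eq_div_iff (by positivity) (by positivity)]
      linear_combination r ^ 2 * hC
    · rw [h₃]
      push_cast
      have hM0' : (M : ℂ) ≠ 0 := by exact_mod_cast hM0
      field_simp
      refine mul_left_cancel₀ hM0' ?_
      linear_combination (M - 1) * sn k θ ^ 2 * hkM - hs2
  refine ⟨⟨fun h => ?_, hsys⟩, fun hd => ?_⟩
  -- The first equation alone gives `dn² θ = r`, and `dn (iτ) > 0` selects the root.
  · have h1 := h.1
    rw [h₁, div_eq_iff (pow_ne_zero 2 hd0)] at h1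
    have hd : dn k θ = (dnR (coModulus k) τ / cnR (coModulus k) τ : ℝ) := hθ ▸ dn_mul_I hk hτ
    have hD0 : 0 < dnR (coModulus k) τ / cnR (coModulus k) τ :=
      div_pos (dnR_pos (coModulus_mem_Ioo hk) τ) (cnR_pos (coModulus_mem_Ioo hk) hτ)
    have hd2 : dn k θ ^ 2 = r := by
      have hr0' : (r : ℂ) ≠ 0 := by exact_mod_cast hr0
      push_cast at h1
      field_simp at h1
      linear_combination r * hdn - h1
    rw [hd] at hd2 ⊢
    rw [ofReal_inj, eq_comm, Real.sqrt_eq_iff_mul_self_eq_of_pos hD0, ← sq]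
    exact_mod_cast hd2
  · obtain ⟨e₁, e₂, e₃⟩ := hsys hd
    have hN : ParametrizedBy
        (fun X Y => A₁ * X ^ 2 * Y ^ 2 + X ^ 2 - 2 * A * X * Y + Y ^ 2 + A₃ = 0)
        (regularSet k (-θ)) (cn k) (fun t => cn k (t - θ)) := by
      intro X Y
      rw [← e₁, ← e₂, ← e₃]
      constructor
      · intro h
        refine exists_cn_of_biquadratic hk hτ hθ ?_
        field_simp at h
        linear_combination h
      · rintro ⟨t, ht, rfl, rfl⟩
        rw [← mul_div_assoc]
        exact cn_biquadratic_div hk ht.1 hreg (by simpa [sub_eq_add_neg] using ht.2) hd0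
    exact ⟨hN.of_iff hp hq hR, hN.of_iff hp hq' hR'⟩

/-- The adjacent relation in the case of the functions `sn`, for a curve with given normal form. -/
lemma adjacent_sn (hM0 : 0 < M) (hM : M < 1) (hk : k = Real.sqrt (1 - M)) {r A₁ A₂ A₃ : ℝ} {A : ℂ}
    (hr : 1 < r) (h₁ : A₁ = r - 1) (hA : A = A₂) (hpos : 0 < A₂)
    (h₂ : A₂ ^ 2 = r * (r - M) / (1 - M)) (h₃ : A₃ = (r - 1) / (1 - M))
    {R R' : ℂ → ℂ → Prop} {p q q' : ℂ} (hp : p ≠ 0) (hq : q ≠ 0) (hq' : q' ≠ 0)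
    (hR : ∀ X Y, R (p * X) (q * Y) ↔
      A₁ * X ^ 2 * Y ^ 2 + X ^ 2 - 2 * A * X * Y + Y ^ 2 + A₃ = 0)
    (hR' : ∀ X Y, R' (p * X) (q' * Y) ↔
      A₁ * X ^ 2 * Y ^ 2 + X ^ 2 - 2 * A * X * Y + Y ^ 2 + A₃ = 0) :
    (∃! τ : ℝ, τ ∈ Ioo 0 (quarterPeriod (coModulus k)) ∧ dn k (τ * I) = Real.sqrt r) ∧
    ∀ τ ∈ Ioo 0 (quarterPeriod (coModulus k)), ∀ θ : ℂ, θ = τ * I →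
      ((-(k : ℂ) ^ 2 * sn k θ ^ 2 = A₁ ∧ cn k θ * dn k θ = A ∧ -sn k θ ^ 2 = A₃) ↔
        dn k θ = Real.sqrt r) ∧
      (dn k θ = Real.sqrt r →
        ParametrizedBy R (regularSet k (-θ)) (fun t => p * sn k t) (fun t => q * sn k (t - θ)) ∧
        ParametrizedBy R' (regularSet k (-θ)) (fun t => p * sn k t)
          (fun t => q' * sn k (t - θ))) := by
  obtain ⟨hk, hk2⟩ := sqrt_one_sub_mem_Ioo hM0 hM hk
  refine ⟨existsUnique_dn_mul_I_eq hk hr, fun τ hτ θ hθ => ?_⟩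
  have hreg : Regular k θ := hθ ▸ regular_mul_I hk hτ
  have hdn := dn_sq hk hreg
  have hsc := sn_sq_add_cn_sq hk hreg
  have hM1 : 1 - M ≠ 0 := by linarith
  have hkM : (k : ℂ) ^ 2 = 1 - M := by exact_mod_cast hk2
  have hd : dn k θ = (dnR (coModulus k) τ / cnR (coModulus k) τ : ℝ) := hθ ▸ dn_mul_I hk hτ
  have hD0 : 0 < dnR (coModulus k) τ / cnR (coModulus k) τ :=
    div_pos (dnR_pos (coModulus_mem_Ioo hk) τ) (cnR_pos (coModulus_mem_Ioo hk) hτ)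
  have hsys : dn k θ = Real.sqrt r → -(k : ℂ) ^ 2 * sn k θ ^ 2 = A₁ ∧
      cn k θ * dn k θ = A ∧ -sn k θ ^ 2 = A₃ := by
    intro hdr
    have hd2 : dn k θ ^ 2 = r := by
      rw [hdr]
      exact_mod_cast Real.sq_sqrt (by linarith : 0 ≤ r)
    have hM1' : (1 - M : ℂ) ≠ 0 := by exact_mod_cast hM1
    refine ⟨?_, ?_, ?_⟩
    · rw [h₁]
      push_cast
      linear_combination hd2 - hdn
    · have hc0 := cnR_pos (coModulus_mem_Ioo hk) hτ
      have hc : cn k θ = (1 / cnR (coModulus k) τ : ℝ) := hθ ▸ cn_mul_I hk hτ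
      have hC : (cn k θ * dn k θ) ^ 2 * (1 - M) = r * (r - M) := by
        linear_combination (1 - M) * cn k θ ^ 2 * hd2 + (1 - M) * r * hsc
          + r * (hd2 - hdn) + r * sn k θ ^ 2 * hkM
      rw [hA, hc, hd, ← ofReal_mul, ofReal_inj]
      rw [hc, hd, ← ofReal_mul] at hC
      refine (sq_eq_sq₀ (by positivity) hpos.le).1 ?_
      rw [h₂, eq_div_iff hM1]
      exact_mod_cast hC
    · rw [h₃]
      push_cast
      rw [eq_div_iff hM1']
      linear_combination hd2 - hdn + sn k θ ^ 2 * hkM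
  refine ⟨⟨fun h => ?_, hsys⟩, fun hdr => ?_⟩
  -- Here too the first equation of the system determines `dn² θ`, and positivity gives the sign.
  · have hd2 : dn k θ ^ 2 = r := by
      have h1 := h.1
      rw [h₁] at h1
      push_cast at h1
      linear_combination hdn + h1
    rw [hd] at hd2 ⊢
    rw [ofReal_inj, eq_comm, Real.sqrt_eq_iff_mul_self_eq_of_pos hD0, ← sq]
    exact_mod_cast hd2
  · obtain ⟨e₁, e₂, e₃⟩ := hsys hdr
    have hN : ParametrizedBy
        (fun X Y => A₁ * X ^ 2 * Y ^ 2 + X ^ 2 - 2 * A * X * Y + Y ^ 2 + A₃ = 0)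
        (regularSet k (-θ)) (sn k) (fun t => sn k (t - θ)) := by
      intro X Y
      rw [← e₁, ← e₂, ← e₃]
      constructor
      · intro h
        refine exists_sn_of_biquadratic hk hτ hθ ?_
        linear_combination h
      · rintro ⟨t, ht, rfl, rfl⟩
        linear_combination sn_biquadratic_sub hk ht.1 hreg
          (by simpa [sub_eq_add_neg] using ht.2)
    exact ⟨hN.of_iff hp hq hR, hN.of_iff hp hq' hR'⟩

end Linkage

section Curves

open Complex

/-! ### Square roots and amplitudes -/

lemma csqrt_sq (a : ℝ) : csqrt a ^ 2 = a := by
  unfold csqrt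
  split_ifs with h
  · exact_mod_cast Real.sq_sqrt h
  · rw [mul_pow, I_sq]
    have := Real.sq_sqrt (show 0 ≤ -a by linarith)
    rw [← ofReal_pow, this]
    push_cast
    ring

lemma csqrt_ne_zero {a : ℝ} (ha : a ≠ 0) : csqrt a ≠ 0 := fun h => ha (by
  have := csqrt_sq a
  rw [h, zero_pow two_ne_zero] at this
  exact_mod_cast this.symm)

lemma csqrt_of_pos {a : ℝ} (ha : 0 < a) : csqrt a = Real.sqrt a := if_pos ha.le

lemma csqrt_of_neg {a : ℝ} (ha : a < 0) : csqrt a = I * Real.sqrt (-a) := if_neg ha.not_ge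

variable {α β γ δ σ M : ℝ}

/-- `ab - (σ - a)(σ - b) = σ(a + b - σ)`; the factored form shows the sign of the radicand. -/
lemma amplitude_sq {a b : ℝ} (ha : σ - a ≠ 0) (hb : σ - b ≠ 0) :
    amplitude σ a b ^ 2 = (σ * (a + b - σ) / ((σ - a) * (σ - b)) : ℝ) := by
  rw [amplitude, csqrt_sq, ofReal_inj]
  field_simp
  ring

lemma amplitude_eq {a b : ℝ} (ha : σ - a ≠ 0) (hb : σ - b ≠ 0) :
    amplitude σ a b = csqrt (σ * (a + b - σ) / ((σ - a) * (σ - b))) := by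
  rw [amplitude]
  congr 1
  field_simp
  ring

lemma amplitude_ne_zero {a b : ℝ} (hσ : σ ≠ 0) (ha : σ - a ≠ 0) (hb : σ - b ≠ 0)
    (hab : a + b - σ ≠ 0) : amplitude σ a b ≠ 0 := by
  rw [amplitude_eq ha hb]
  exact csqrt_ne_zero (div_ne_zero (mul_ne_zero hσ hab) (mul_ne_zero ha hb))

/-! ### The linkage -/

/-- The lengths of a linkage of semi-perimeter `σ`. -/
structure Lengths (σ α β γ δ : ℝ) : Prop where
  pos_α : 0 < α
  pos_β : 0 < β
  pos_γ : 0 < γ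
  pos_δ : 0 < δ
  sub_α : 0 < σ - α
  sub_β : 0 < σ - β
  sub_γ : 0 < σ - γ
  sub_δ : 0 < σ - δ
  sum_eq : δ = 2 * σ - α - β - γ

lemma Lengths.pos (h : Lengths σ α β γ δ) : 0 < σ := by linarith [h.pos_α, h.sub_α]

/-- This cyclic shift reduces the pair `w`, `x` to the pair `x`, `y`. -/
lemma Lengths.rotate (h : Lengths σ α β γ δ) : Lengths σ δ α β γ :=
  ⟨h.pos_δ, h.pos_α, h.pos_β, h.pos_γ, h.sub_δ, h.sub_α, h.sub_β, h.sub_γ,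
    by linarith [h.sum_eq]⟩

lemma Lengths.semiperimeter_eq (h : Lengths σ α β γ δ) : semiperimeter α β γ δ = σ := by
  rw [semiperimeter, h.sum_eq]
  ring

lemma IsLinkage.lengths (h : IsLinkage α β γ δ) : Lengths (semiperimeter α β γ δ) α β γ δ := by
  obtain ⟨h1, h2, h3, h4, h5, h6, h7, h8⟩ := h
  unfold semiperimeter
  constructor <;> linarith

lemma Lengths.linkageM_eq (h : Lengths σ α β γ δ) :
    linkageM α β γ δ = α * β * γ * δ / ((σ - α) * (σ - β) * (σ - γ) * (σ - δ)) := by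
  simp only [linkageM, h.semiperimeter_eq]

lemma Lengths.linkageM_pos (h : Lengths σ α β γ δ) : 0 < linkageM α β γ δ := by
  rw [h.linkageM_eq]
  have h1 := h.pos_α
  have h2 := h.pos_β
  have h3 := h.pos_γ
  have h4 := h.pos_δ
  have h5 := h.sub_α
  have h6 := h.sub_β
  have h7 := h.sub_γ
  have h8 := h.sub_δ
  positivity

lemma Lengths.linkageM_sub_one (h : Lengths σ α β γ δ) :
    linkageM α β γ δ - 1 = σ * (σ - α - γ) * ((σ - α - β) * (σ - β - γ))
      / ((σ - α) * (σ - β) * (σ - γ) * (σ - δ)) := by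
  have h5 := h.sub_α.ne'
  have h6 := h.sub_β.ne'
  have h7 := h.sub_γ.ne'
  have h8 := h.sub_δ.ne'
  rw [h.linkageM_eq, div_sub_one (by positivity)]
  congr 1
  rw [h.sum_eq]
  ring

lemma Lengths.linkageM_rotate (h : Lengths σ α β γ δ) :
    linkageM δ α β γ = linkageM α β γ δ := by
  rw [h.linkageM_eq, h.rotate.linkageM_eq]
  congr 1 <;> ring

lemma Lengths.px_eq (h : Lengths σ α β γ δ) : px α β γ δ = amplitude σ α β := by
  rw [px, h.semiperimeter_eq]

lemma Lengths.py_eq (h : Lengths σ α β γ δ) : py α β γ δ = amplitude σ β γ := by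
  rw [py, h.semiperimeter_eq]

lemma Lengths.pz_eq (h : Lengths σ α β γ δ) : pz α β γ δ = amplitude σ γ δ := by
  rw [pz, h.semiperimeter_eq]

lemma Lengths.pw_eq (h : Lengths σ α β γ δ) : pw α β γ δ = amplitude σ δ α := by
  rw [pw, h.semiperimeter_eq]

/-! ### Opposite angles -/

lemma oppositeEq_iff (hx : px α β γ δ ≠ 0) (hz : pz α β γ δ ≠ 0) (X Z : ℂ) :
    OppositeEq α β γ δ (px α β γ δ * X) (pz α β γ δ * Z) ↔
      (linkageM α β γ δ - 1) * X ^ 2 * Z ^ 2 + X ^ 2 + Z ^ 2 - 1 = 0 := by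
  rw [OppositeEq]
  refine Eq.congr_left ?_
  field_simp

/-- After rescaling, `g` is `σ(α + β - σ)` times the normal form; the signs agree because `γ + δ - σ
= -(α + β - σ)`. -/
lemma Lengths.g_eq_zero_iff (h : Lengths σ α β γ δ) (hne : α + β ≠ σ) (X Z : ℂ) :
    g α β γ δ (px α β γ δ * X) (pz α β γ δ * Z) = 0 ↔
      (linkageM α β γ δ - 1) * X ^ 2 * Z ^ 2 + X ^ 2 + Z ^ 2 - 1 = 0 := by
  have h5 := h.sub_α.ne'
  have h6 := h.sub_β.ne'
  have h7 := h.sub_γ.ne'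
  have h8 := h.sub_δ.ne'
  have hc : σ * (α + β - σ) ≠ 0 := mul_ne_zero h.pos.ne' (sub_ne_zero.2 hne)
  have e1 : (σ - α) * (σ - β) * (σ * (α + β - σ) / ((σ - α) * (σ - β))) = σ * (α + β - σ) := by
    field_simp
  have e2 : -((σ - γ) * (σ - δ)) * (σ * (γ + δ - σ) / ((σ - γ) * (σ - δ))) = σ * (α + β - σ) := by
    have : γ + δ - σ = -(α + β - σ) := by rw [h.sum_eq]; ring
    rw [this]
    field_simp
  have e3 : (σ - α - γ) * (σ - β - γ) * (σ * (α + β - σ) / ((σ - α) * (σ - β)))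
      * (σ * (γ + δ - σ) / ((σ - γ) * (σ - δ))) = σ * (α + β - σ) * (linkageM α β γ δ - 1) := by
    have : γ + δ - σ = -(α + β - σ) := by rw [h.sum_eq]; ring
    rw [h.linkageM_sub_one, this]
    field_simp
    ring
  have key : g α β γ δ (px α β γ δ * X) (pz α β γ δ * Z) = (σ * (α + β - σ) : ℝ)
      * ((linkageM α β γ δ - 1) * X ^ 2 * Z ^ 2 + X ^ 2 + Z ^ 2 - 1) := by
    simp only [g, h.semiperimeter_eq, h.px_eq, h.pz_eq, mul_pow, amplitude_sq h5 h6,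
      amplitude_sq h7 h8]
    have e1' := congrArg (ofReal) e1
    have e2' := congrArg (ofReal) e2
    have e3' := congrArg (ofReal) e3
    push_cast at e1' e2' e3' ⊢
    linear_combination X ^ 2 * Z ^ 2 * e3' + X ^ 2 * e1' + Z ^ 2 * e2'
  rw [key, mul_eq_zero, or_iff_right (by exact_mod_cast hc)]

/-! ### Adjacent angles -/

lemma Lengths.sub_mul_sub_sub (h : Lengths σ α β γ δ) :
    (σ - α) * (σ - γ) - β * δ = (σ - α - β) * (σ - β - γ) := by
  rw [h.sum_eq]
  ring

lemma Lengths.adjacentEq_iff (h : Lengths σ α β γ δ) (hx : px α β γ δ ≠ 0) (hy : py α β γ δ ≠ 0)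
    (X Y : ℂ) :
    AdjacentEq α β γ δ (px α β γ δ * X) (py α β γ δ * Y) ↔
      ((α * γ / ((σ - α) * (σ - γ)) - 1 : ℝ) : ℂ) * X ^ 2 * Y ^ 2 + X ^ 2
        - 2 * (α * γ / csqrt ((σ - α) * (σ - γ) * ((σ - α) * (σ - γ) - β * δ))) * X * Y + Y ^ 2
        + (((σ - β) * (σ - δ) / ((σ - α) * (σ - γ) - β * δ) : ℝ) : ℂ) = 0 := by
  simp only [AdjacentEq, h.semiperimeter_eq]
  refine Eq.congr_left ?_
  have e1 : (px α β γ δ * X) ^ 2 * (py α β γ δ * Y) ^ 2 / (px α β γ δ ^ 2 * py α β γ δ ^ 2)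
      = X ^ 2 * Y ^ 2 := by field_simp
  have e2 : (px α β γ δ * X) ^ 2 / px α β γ δ ^ 2 = X ^ 2 := by field_simp
  have e3 : (py α β γ δ * Y) ^ 2 / py α β γ δ ^ 2 = Y ^ 2 := by field_simp
  have e4 : px α β γ δ * X * (py α β γ δ * Y) / (px α β γ δ * py α β γ δ) = X * Y := by
    field_simp
  rw [e1, e2, e3, e4]
  ring

lemma Lengths.adjacentEq₂_iff (h : Lengths σ α β γ δ) (W X : ℂ) :
    AdjacentEq₂ α β γ δ X W ↔ AdjacentEq δ α β γ W X := by
  have h2 : py δ α β γ = px α β γ δ := by rw [h.rotate.py_eq, h.px_eq]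
  have h3 : px δ α β γ = pw α β γ δ := by rw [h.rotate.px_eq, h.pw_eq]
  simp only [AdjacentEq, AdjacentEq₂, h.semiperimeter_eq, h.rotate.semiperimeter_eq, h2, h3]
  refine Eq.congr_left ?_
  rw [mul_comm β δ, mul_comm (σ - β) (σ - δ), mul_comm (σ - α) (σ - γ), mul_comm α γ]
  ring

lemma f_rotate (W X : ℂ) : f β α δ γ X W = f δ α β γ W X := by
  have h1 : semiperimeter β α δ γ = semiperimeter α β γ δ := by unfold semiperimeter; ring
  have h2 : semiperimeter δ α β γ = semiperimeter α β γ δ := by unfold semiperimeter; ring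
  simp only [f, f22, f20, f11, f02, f00, h1, h2]
  push_cast
  ring

/-- The amplitudes multiplied by the correct sign. -/
lemma Lengths.sign_mul_px_mul_py (h : Lengths σ α β γ δ)
    (hQ : 0 < (σ - α - β) * (σ - β - γ)) :
    (if σ < α + β then 1 else -1 : ℂ) * px α β γ δ * py α β γ δ
      * csqrt ((σ - α) * (σ - γ) * ((σ - α) * (σ - γ) - β * δ))
      = (σ * ((σ - α - β) * (σ - β - γ)) / (σ - β) : ℝ) := by
  have hσ := h.pos
  have h5 := h.sub_α
  have h6 := h.sub_β
  have h7 := h.sub_γ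
  have hD : 0 < (σ - α) * (σ - γ) * ((σ - α - β) * (σ - β - γ)) := by positivity
  rw [h.px_eq, h.py_eq, amplitude_eq h5.ne' h6.ne', amplitude_eq h6.ne' h7.ne', h.sub_mul_sub_sub,
    csqrt_of_pos hD]
  -- The sign `s = ±1` makes the first two radicands positive in the two cases below; the product of
  -- all three is a perfect square independent of `s`.
  have key (s : ℝ) (hs : s ^ 2 = 1) : Real.sqrt (s * (σ * (α + β - σ) / ((σ - α) * (σ - β))))
      * Real.sqrt (s * (σ * (β + γ - σ) / ((σ - β) * (σ - γ))))
      * Real.sqrt ((σ - α) * (σ - γ) * ((σ - α - β) * (σ - β - γ)))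
      = σ * ((σ - α - β) * (σ - β - γ)) / (σ - β) ∨
      s * (σ * (α + β - σ) / ((σ - α) * (σ - β))) < 0 := by
    refine or_iff_not_imp_right.2 fun hneg => ?_
    rw [not_lt] at hneg
    have hprod : s * (σ * (α + β - σ) / ((σ - α) * (σ - β)))
        * (s * (σ * (β + γ - σ) / ((σ - β) * (σ - γ))))
        * ((σ - α) * (σ - γ) * ((σ - α - β) * (σ - β - γ)))
        = (σ * ((σ - α - β) * (σ - β - γ)) / (σ - β)) ^ 2 := by
      field_simp
      rw [hs]
      ring
    rw [← Real.sqrt_mul hneg, ← Real.sqrt_mul' _ hD.le, hprod, Real.sqrt_sq (by positivity)]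
  rcases lt_or_ge σ (α + β) with hlt | hge
  · have hx : 0 < α + β - σ := by linarith
    have hy : 0 < β + γ - σ := by nlinarith
    have hX : 0 < σ * (α + β - σ) / ((σ - α) * (σ - β)) := by positivity
    have hY : 0 < σ * (β + γ - σ) / ((σ - β) * (σ - γ)) := by positivity
    have := (key 1 (by norm_num)).resolve_right (by linarith)
    rw [one_mul, one_mul] at this
    rw [if_pos hlt, csqrt_of_pos hX, csqrt_of_pos hY, ← this]
    push_cast
    ring
  · have hx : 0 < σ - α - β := by
      rcases (by linarith : 0 ≤ σ - α - β).eq_or_lt with h0 | h0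
      · rw [← h0, zero_mul] at hQ
        exact absurd hQ (lt_irrefl 0)
      · exact h0
    have hy : 0 < σ - β - γ := pos_of_mul_pos_right hQ hx.le
    have hX : σ * (α + β - σ) / ((σ - α) * (σ - β)) < 0 :=
      div_neg_of_neg_of_pos (mul_neg_of_pos_of_neg hσ (by linarith)) (by positivity)
    have hY : σ * (β + γ - σ) / ((σ - β) * (σ - γ)) < 0 :=
      div_neg_of_neg_of_pos (mul_neg_of_pos_of_neg hσ (by linarith)) (by positivity)
    have := (key (-1) (by norm_num)).resolve_right (by linarith)
    rw [neg_one_mul, neg_one_mul] at this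
    rw [if_neg hge.not_gt, csqrt_of_neg hX, csqrt_of_neg hY, ← this]
    push_cast
    -- Both amplitudes are imaginary here, and `i² = -1` cancels `ε = -1`.
    linear_combination (-1 : ℂ) * Real.sqrt (-(σ * (α + β - σ) / ((σ - α) * (σ - β))))
      * Real.sqrt (-(σ * (β + γ - σ) / ((σ - β) * (σ - γ))))
      * Real.sqrt ((σ - α) * (σ - γ) * ((σ - α - β) * (σ - β - γ))) * I_sq

/-- After rescaling, `f` is `E = σ(σ - α - β)(σ - β - γ)/(σ - β)` times the normal form. Only the
mixed term feels `ε`, and there `sign_mul_px_mul_py` applies. -/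
lemma Lengths.f_eq_zero_iff (h : Lengths σ α β γ δ) (hQ : 0 < (σ - α - β) * (σ - β - γ)) {ε : ℂ}
    (hε : ε = if σ < α + β then 1 else -1) (X Y : ℂ) :
    f α β γ δ (px α β γ δ * X) (ε * py α β γ δ * Y) = 0 ↔
      ((α * γ / ((σ - α) * (σ - γ)) - 1 : ℝ) : ℂ) * X ^ 2 * Y ^ 2 + X ^ 2
        - 2 * (α * γ / csqrt ((σ - α) * (σ - γ) * ((σ - α) * (σ - γ) - β * δ))) * X * Y + Y ^ 2
        + (((σ - β) * (σ - δ) / ((σ - α) * (σ - γ) - β * δ) : ℝ) : ℂ) = 0 := by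
  have hσ := h.pos
  have h5 := h.sub_α.ne'
  have h6 := h.sub_β.ne'
  have h7 := h.sub_γ.ne'
  have hQ1 := left_ne_zero_of_mul hQ.ne'
  have hQ2 := right_ne_zero_of_mul hQ.ne'
  have hD : (σ - α) * (σ - γ) * ((σ - α) * (σ - γ) - β * δ) ≠ 0 := by
    rw [h.sub_mul_sub_sub]
    exact mul_ne_zero (mul_ne_zero h5 h7) hQ.ne'
  have hDc : csqrt ((σ - α) * (σ - γ) * ((σ - α) * (σ - γ) - β * δ)) ≠ 0 :=
    csqrt_ne_zero hD
  have hE : σ * ((σ - α - β) * (σ - β - γ)) / (σ - β) ≠ 0 := div_ne_zero (by positivity) h6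
  have hε2 : ε ^ 2 = 1 := by rw [hε]; split_ifs <;> norm_num
  have e4 := h.sign_mul_px_mul_py hQ
  rw [← hε, ← eq_div_iff hDc] at e4
  have d1 : σ - α - δ = -(σ - β - γ) := by rw [h.sum_eq]; ring
  have d2 : σ - γ - δ = -(σ - α - β) := by rw [h.sum_eq]; ring
  have d3 : σ - β - δ = -(σ - α - γ) := by rw [h.sum_eq]; ring
  have e1 : (σ - α) * (σ - α - δ) * (σ * (α + β - σ) / ((σ - α) * (σ - β)))
      = σ * ((σ - α - β) * (σ - β - γ)) / (σ - β) := by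
    rw [d1]
    field_simp
    ring
  have e2 : (σ - γ) * (σ - γ - δ) * (σ * (β + γ - σ) / ((σ - β) * (σ - γ)))
      = σ * ((σ - α - β) * (σ - β - γ)) / (σ - β) := by
    rw [d2]
    field_simp
    ring
  have e3 : (σ - β) * (σ - β - δ) * (σ * (α + β - σ) / ((σ - α) * (σ - β)))
      * (σ * (β + γ - σ) / ((σ - β) * (σ - γ)))
      = σ * ((σ - α - β) * (σ - β - γ)) / (σ - β) * (α * γ / ((σ - α) * (σ - γ)) - 1) := by
    rw [d3]
    field_simp
    ring
  have e5 : σ * (σ - δ) = σ * ((σ - α - β) * (σ - β - γ)) / (σ - β)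
      * ((σ - β) * (σ - δ) / ((σ - α) * (σ - γ) - β * δ)) := by
    rw [h.sub_mul_sub_sub]
    field_simp
  have key : f α β γ δ (px α β γ δ * X) (ε * py α β γ δ * Y)
      = (σ * ((σ - α - β) * (σ - β - γ)) / (σ - β) : ℝ)
      * (((α * γ / ((σ - α) * (σ - γ)) - 1 : ℝ) : ℂ) * X ^ 2 * Y ^ 2 + X ^ 2
        - 2 * (α * γ / csqrt ((σ - α) * (σ - γ) * ((σ - α) * (σ - γ) - β * δ))) * X * Y + Y ^ 2
        + (((σ - β) * (σ - δ) / ((σ - α) * (σ - γ) - β * δ) : ℝ) : ℂ)) := by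
    have hx2 : px α β γ δ ^ 2 = _ := h.px_eq ▸ amplitude_sq h5 h6
    have hy2 : py α β γ δ ^ 2 = _ := h.py_eq ▸ amplitude_sq h6 h7
    have e1' := congrArg (ofReal) e1
    have e2' := congrArg (ofReal) e2
    have e3' := congrArg (ofReal) e3
    have e5' := congrArg (ofReal) e5
    simp only [ofReal_mul _ (σ * (α + β - σ) / ((σ - α) * (σ - β))),
      ofReal_mul _ (σ * (β + γ - σ) / ((σ - β) * (σ - γ))), ← hx2, ← hy2] at e1' e2' e3'
    rw [ofReal_mul (σ * ((σ - α - β) * (σ - β - γ)) / (σ - β))] at e3' e5'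
    simp only [f, f22, f20, f11, f02, f00, h.semiperimeter_eq]
    generalize ((σ * ((σ - α - β) * (σ - β - γ)) / (σ - β) : ℝ) : ℂ) = E at *
    generalize ((α * γ / ((σ - α) * (σ - γ)) - 1 : ℝ) : ℂ) = A₁ at *
    generalize (((σ - β) * (σ - δ) / ((σ - α) * (σ - γ) - β * δ) : ℝ) : ℂ) = A₃ at *
    rw [e5']
    push_cast at e1' e2' e3' ⊢
    linear_combination X ^ 2 * e1' + Y ^ 2 * e2' + X ^ 2 * Y ^ 2 * e3'
      - 2 * α * γ * X * Y * e4
      + ((σ - β) * (σ - β - δ) * px α β γ δ ^ 2 * py α β γ δ ^ 2 * X ^ 2 * Y ^ 2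
        + (σ - γ) * (σ - γ - δ) * py α β γ δ ^ 2 * Y ^ 2) * hε2
  rw [key, mul_eq_zero, or_iff_right (by exact_mod_cast hE)]

end Curves

/-! ### Adjacent relations of a linkage: sign conditions and the choice of phase shift. -/

section Adjacent

open Complex

variable {α β γ δ σ k : ℝ} {ε : ℂ}

/-- The left side is a positive multiple of `(σ - α - γ)² (σ - α - β)(σ - β - γ)`. It converts the
case distinction on `M` and `α + γ` into positivity of the radicand. -/
lemma Lengths.mul_sub_pos_iff (h : Lengths σ α β γ δ) :
    0 < (linkageM α β γ δ - 1) * (σ - α - γ) ↔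
      α + γ ≠ σ ∧ 0 < (σ - α - β) * (σ - β - γ) := by
  have hσ := h.pos
  have h5 := h.sub_α
  have h6 := h.sub_β
  have h7 := h.sub_γ
  have h8 := h.sub_δ
  have e : (linkageM α β γ δ - 1) * (σ - α - γ)
      = (σ / ((σ - α) * (σ - β) * (σ - γ) * (σ - δ))) * (σ - α - γ) ^ 2
        * ((σ - α - β) * (σ - β - γ)) := by
    rw [h.linkageM_sub_one]
    ring
  rw [e]
  constructor
  · intro h0
    have hne : σ - α - γ ≠ 0 := fun h1 => by simp [h1] at h0
    exact ⟨fun h1 => hne (by linarith), pos_of_mul_pos_right h0 (by positivity)⟩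
  · rintro ⟨h1, h2⟩
    have hne : σ - α - γ ≠ 0 := fun h0 => h1 (by linarith)
    positivity

lemma Lengths.amplitudes_ne_zero (h : Lengths σ α β γ δ)
    (hQ : 0 < (σ - α - β) * (σ - β - γ)) : px α β γ δ ≠ 0 ∧ py α β γ δ ≠ 0 := by
  have hQ1 := left_ne_zero_of_mul hQ.ne'
  have hQ2 := right_ne_zero_of_mul hQ.ne'
  rw [h.px_eq, h.py_eq]
  exact ⟨amplitude_ne_zero h.pos.ne' h.sub_α.ne' h.sub_β.ne' fun h0 => hQ1 (by linarith),
    amplitude_ne_zero h.pos.ne' h.sub_β.ne' h.sub_γ.ne' fun h0 => hQ2 (by linarith)⟩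

/-- The coefficient of `x y` in the normal form, as a real number. -/
lemma Lengths.cross_coefficient (h : Lengths σ α β γ δ) (hQ : 0 < (σ - α - β) * (σ - β - γ)) :
    ∃ A : ℝ, α * γ / csqrt ((σ - α) * (σ - γ) * ((σ - α) * (σ - γ) - β * δ)) = (A : ℂ) ∧ 0 < A ∧
      A ^ 2 = (α * γ) ^ 2 / ((σ - α) * (σ - γ) * ((σ - α - β) * (σ - β - γ))) := by
  have h1 := h.pos_α
  have h3 := h.pos_γ
  have h5 := h.sub_α
  have h7 := h.sub_γ
  have hD : 0 < (σ - α) * (σ - γ) * ((σ - α - β) * (σ - β - γ)) := by positivity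
  refine ⟨α * γ / Real.sqrt ((σ - α) * (σ - γ) * ((σ - α - β) * (σ - β - γ))), ?_, ?_, ?_⟩
  · rw [h.sub_mul_sub_sub, csqrt_of_pos hD]
    push_cast
    rfl
  · have := Real.sqrt_pos.2 hD
    positivity
  · rw [div_pow, Real.sq_sqrt hD.le]

lemma sign_ne_zero (hε : ε = if σ < α + β then 1 else -1) : ε ≠ 0 := by
  rw [hε]
  split_ifs <;> norm_num

lemma Lengths.adjacent_cn (h : Lengths σ α β γ δ) (hM : 1 < linkageM α β γ δ)
    (hk : k = Real.sqrt (1 - 1 / linkageM α β γ δ)) (hlt : α + γ < σ)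
    (hε : ε = if σ < α + β then 1 else -1) :
    (∃! τ : ℝ, τ ∈ Ioo 0 (quarterPeriod (coModulus k)) ∧
      dn k (τ * I) = Real.sqrt ((σ - α) * (σ - γ) / (α * γ))) ∧
    ∀ τ ∈ Ioo 0 (quarterPeriod (coModulus k)), ∀ θ : ℂ, θ = τ * I →
      ((k ^ 2 * sn k θ ^ 2 / dn k θ ^ 2 = ((α * γ / ((σ - α) * (σ - γ)) - 1 : ℝ) : ℂ) ∧
        cn k θ / dn k θ ^ 2
          = α * γ / csqrt ((σ - α) * (σ - γ) * ((σ - α) * (σ - γ) - β * δ)) ∧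
        (k ^ 2 - 1) * sn k θ ^ 2 / dn k θ ^ 2
          = (((σ - β) * (σ - δ) / ((σ - α) * (σ - γ) - β * δ) : ℝ) : ℂ)) ↔
        dn k θ = Real.sqrt ((σ - α) * (σ - γ) / (α * γ))) ∧
      (dn k θ = Real.sqrt ((σ - α) * (σ - γ) / (α * γ)) →
        ParametrizedBy (AdjacentEq α β γ δ) (regularSet k (-θ))
          (fun t => px α β γ δ * cn k t) (fun t => py α β γ δ * cn k (t - θ)) ∧
        ParametrizedBy (fun x y => f α β γ δ x y = 0) (regularSet k (-θ))
          (fun t => px α β γ δ * cn k t) (fun t => ε * py α β γ δ * cn k (t - θ))) := by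
  have h1 := h.pos_α
  have h3 := h.pos_γ
  have h5 := h.sub_α
  have h6 := h.sub_β
  have h7 := h.sub_γ
  have h8 := h.sub_δ
  have hσ := h.pos
  have hu : 0 < σ - α - γ := by linarith
  have hQ := (h.mul_sub_pos_iff.1 (mul_pos (sub_pos.2 hM) hu)).2
  obtain ⟨hx, hy⟩ := h.amplitudes_ne_zero hQ
  obtain ⟨A, hA, hA0, hA2⟩ := h.cross_coefficient hQ
  have hM1 := h.linkageM_sub_one
  have hr : (σ - α) * (σ - γ) - α * γ = σ * (σ - α - γ) := by ring
  have hQ1 := left_ne_zero_of_mul hQ.ne'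
  have hQ2 := right_ne_zero_of_mul hQ.ne'
  refine FourBar.adjacent_cn hM hk ?_ ?_ hA hA0 ?_ ?_ hx hy (mul_ne_zero (sign_ne_zero hε) hy)
    (h.adjacentEq_iff hx hy) (h.f_eq_zero_iff hQ hε)
  · rw [one_lt_div (by positivity)]
    nlinarith
  · rw [one_div_div]
  -- Here `rM = βδ / ((σ - β)(σ - δ))`, and `β + δ - σ = σ - α - γ`.
  · have e : (σ - α) * (σ - γ) / (α * γ) * linkageM α β γ δ - 1
        = σ * (σ - α - γ) / ((σ - β) * (σ - δ)) := by
      rw [h.linkageM_eq]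
      field_simp
      rw [h.sum_eq]
      ring
    rw [hA2, e, hM1]
    field_simp
  · rw [hM1, one_div_div, h.sub_mul_sub_sub, one_sub_div (by positivity), hr]
    field_simp

lemma Lengths.adjacent_sn (h : Lengths σ α β γ δ) (hM : linkageM α β γ δ < 1)
    (hk : k = Real.sqrt (1 - linkageM α β γ δ)) (hlt : σ < α + γ)
    (hε : ε = if σ < α + β then 1 else -1) :
    (∃! τ : ℝ, τ ∈ Ioo 0 (quarterPeriod (coModulus k)) ∧
      dn k (τ * I) = Real.sqrt (α * γ / ((σ - α) * (σ - γ)))) ∧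
    ∀ τ ∈ Ioo 0 (quarterPeriod (coModulus k)), ∀ θ : ℂ, θ = τ * I →
      ((-(k : ℂ) ^ 2 * sn k θ ^ 2 = ((α * γ / ((σ - α) * (σ - γ)) - 1 : ℝ) : ℂ) ∧
        cn k θ * dn k θ
          = α * γ / csqrt ((σ - α) * (σ - γ) * ((σ - α) * (σ - γ) - β * δ)) ∧
        -sn k θ ^ 2
          = (((σ - β) * (σ - δ) / ((σ - α) * (σ - γ) - β * δ) : ℝ) : ℂ)) ↔
        dn k θ = Real.sqrt (α * γ / ((σ - α) * (σ - γ)))) ∧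
      (dn k θ = Real.sqrt (α * γ / ((σ - α) * (σ - γ))) →
        ParametrizedBy (AdjacentEq α β γ δ) (regularSet k (-θ))
          (fun t => px α β γ δ * sn k t) (fun t => py α β γ δ * sn k (t - θ)) ∧
        ParametrizedBy (fun x y => f α β γ δ x y = 0) (regularSet k (-θ))
          (fun t => px α β γ δ * sn k t) (fun t => ε * py α β γ δ * sn k (t - θ))) := by
  have h1 := h.pos_α
  have h3 := h.pos_γ
  have h5 := h.sub_α
  have h6 := h.sub_β
  have h7 := h.sub_γ
  have h8 := h.sub_δ
  have hσ := h.pos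
  have hu : σ - α - γ < 0 := by linarith
  have hQ := (h.mul_sub_pos_iff.1 (mul_pos_of_neg_of_neg (sub_neg.2 hM) hu)).2
  obtain ⟨hx, hy⟩ := h.amplitudes_ne_zero hQ
  obtain ⟨A, hA, hA0, hA2⟩ := h.cross_coefficient hQ
  have hM1 : 1 - linkageM α β γ δ = -(linkageM α β γ δ - 1) := by ring
  rw [h.linkageM_sub_one] at hM1
  have hQ1 := left_ne_zero_of_mul hQ.ne'
  have hQ2 := right_ne_zero_of_mul hQ.ne'
  have hu' := hu.ne
  have hr : α * γ / ((σ - α) * (σ - γ)) - 1 = -(σ * (σ - α - γ)) / ((σ - α) * (σ - γ)) := by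
    field_simp
    ring
  refine FourBar.adjacent_sn h.linkageM_pos hM hk ?_ rfl hA hA0 ?_ ?_ hx hy
    (mul_ne_zero (sign_ne_zero hε) hy) (h.adjacentEq_iff hx hy) (h.f_eq_zero_iff hQ hε)
  · rw [one_lt_div (by positivity)]
    nlinarith
  · have e : α * γ / ((σ - α) * (σ - γ)) - linkageM α β γ δ
        = -(α * γ * (σ * (σ - α - γ))) / ((σ - α) * (σ - β) * (σ - γ) * (σ - δ)) := by
      rw [h.linkageM_eq]
      field_simp
      rw [h.sum_eq]
      ring
    rw [hA2, e, hM1]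
    field_simp
  · rw [hM1, hr, h.sub_mul_sub_sub]
    field_simp

/-- The sign attached to the pair `w`, `x` agrees with the one attached to the pair `x`, `y`. -/
lemma sign_rotate (hQ : 0 < (σ - δ - α) * (σ - α - β)) (hε : ε = if σ < α + β then 1 else -1) :
    ε = if σ < δ + α then 1 else -1 := by
  -- The two factors in `hQ` have the same sign.
  have : σ < α + β ↔ σ < δ + α := by
    constructor <;> intro h0 <;> nlinarith
  rw [hε]
  simp only [this]

lemma Lengths.adjacentEq₂_eq (h : Lengths σ α β γ δ) :
    (fun w x => AdjacentEq₂ α β γ δ x w) = AdjacentEq δ α β γ := by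
  funext w x
  exact propext (h.adjacentEq₂_iff w x)

/-- Rotation leaves `M` and `ε` unchanged and turns `α + γ > σ` into `δ + β < σ`, so
`Lengths.adjacent_cn` applies to the rotated lengths. -/
lemma Lengths.adjacent₂_cn (h : Lengths σ α β γ δ) (hM : 1 < linkageM α β γ δ)
    (hk : k = Real.sqrt (1 - 1 / linkageM α β γ δ)) (hlt : σ < α + γ)
    (hε : ε = if σ < α + β then 1 else -1) :
    (∃! τ : ℝ, τ ∈ Ioo 0 (quarterPeriod (coModulus k)) ∧
      dn k (τ * I) = Real.sqrt ((σ - β) * (σ - δ) / (β * δ))) ∧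
    ∀ τ ∈ Ioo 0 (quarterPeriod (coModulus k)), ∀ θ : ℂ, θ = τ * I →
      ((k ^ 2 * sn k θ ^ 2 / dn k θ ^ 2 = ((β * δ / ((σ - β) * (σ - δ)) - 1 : ℝ) : ℂ) ∧
        cn k θ / dn k θ ^ 2
          = β * δ / csqrt ((σ - β) * (σ - δ) * ((σ - β) * (σ - δ) - α * γ)) ∧
        (k ^ 2 - 1) * sn k θ ^ 2 / dn k θ ^ 2
          = (((σ - α) * (σ - γ) / ((σ - β) * (σ - δ) - α * γ) : ℝ) : ℂ)) ↔
        dn k θ = Real.sqrt ((σ - β) * (σ - δ) / (β * δ))) ∧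
      (dn k θ = Real.sqrt ((σ - β) * (σ - δ) / (β * δ)) →
        ParametrizedBy (fun w x => AdjacentEq₂ α β γ δ x w) (regularSet k (-θ))
          (fun t => pw α β γ δ * cn k t) (fun t => px α β γ δ * cn k (t - θ)) ∧
        ParametrizedBy (fun w x => f β α δ γ x w = 0) (regularSet k (-θ))
          (fun t => pw α β γ δ * cn k t) (fun t => ε * px α β γ δ * cn k (t - θ))) := by
  have hM' := h.linkageM_rotate
  have hlt' : δ + β < σ := by linarith [h.sum_eq]
  have hQ := (h.rotate.mul_sub_pos_iff.1
    (mul_pos (sub_pos.2 (hM'.symm ▸ hM)) (by linarith : 0 < σ - δ - β))).2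
  have key := h.rotate.adjacent_cn (hM'.symm ▸ hM) (hM'.symm ▸ hk) hlt' (sign_rotate hQ hε)
  have h2 : py δ α β γ = px α β γ δ := by rw [h.rotate.py_eq, h.px_eq]
  have h3 : px δ α β γ = pw α β γ δ := by rw [h.rotate.px_eq, h.pw_eq]
  simp only [mul_comm δ β, mul_comm (δ : ℂ) β, mul_comm (σ - δ) (σ - β), h2, h3] at key
  rw [h.adjacentEq₂_eq]
  simpa only [f_rotate] using key

lemma Lengths.adjacent₂_sn (h : Lengths σ α β γ δ) (hM : linkageM α β γ δ < 1)
    (hk : k = Real.sqrt (1 - linkageM α β γ δ)) (hlt : α + γ < σ)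
    (hε : ε = if σ < α + β then 1 else -1) :
    (∃! τ : ℝ, τ ∈ Ioo 0 (quarterPeriod (coModulus k)) ∧
      dn k (τ * I) = Real.sqrt (β * δ / ((σ - β) * (σ - δ)))) ∧
    ∀ τ ∈ Ioo 0 (quarterPeriod (coModulus k)), ∀ θ : ℂ, θ = τ * I →
      ((-(k : ℂ) ^ 2 * sn k θ ^ 2 = ((β * δ / ((σ - β) * (σ - δ)) - 1 : ℝ) : ℂ) ∧
        cn k θ * dn k θ
          = β * δ / csqrt ((σ - β) * (σ - δ) * ((σ - β) * (σ - δ) - α * γ)) ∧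
        -sn k θ ^ 2
          = (((σ - α) * (σ - γ) / ((σ - β) * (σ - δ) - α * γ) : ℝ) : ℂ)) ↔
        dn k θ = Real.sqrt (β * δ / ((σ - β) * (σ - δ)))) ∧
      (dn k θ = Real.sqrt (β * δ / ((σ - β) * (σ - δ))) →
        ParametrizedBy (fun w x => AdjacentEq₂ α β γ δ x w) (regularSet k (-θ))
          (fun t => pw α β γ δ * sn k t) (fun t => px α β γ δ * sn k (t - θ)) ∧
        ParametrizedBy (fun w x => f β α δ γ x w = 0) (regularSet k (-θ))
          (fun t => pw α β γ δ * sn k t) (fun t => ε * px α β γ δ * sn k (t - θ))) := by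
  have hM' := h.linkageM_rotate
  have hlt' : σ < δ + β := by linarith [h.sum_eq]
  have hQ := (h.rotate.mul_sub_pos_iff.1 (mul_pos_of_neg_of_neg
    (sub_neg.2 (hM'.symm ▸ hM)) (by linarith : σ - δ - β < 0))).2
  have key := h.rotate.adjacent_sn (hM'.symm ▸ hM) (hM'.symm ▸ hk) hlt' (sign_rotate hQ hε)
  have h2 : py δ α β γ = px α β γ δ := by rw [h.rotate.py_eq, h.px_eq]
  have h3 : px δ α β γ = pw α β γ δ := by rw [h.rotate.px_eq, h.pw_eq]
  simp only [mul_comm δ β, mul_comm (δ : ℂ) β, mul_comm (σ - δ) (σ - β), h2, h3] at key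
  rw [h.adjacentEq₂_eq]
  simpa only [f_rotate] using key

end Adjacent

end FourBar

/-! ### The parametrization theorem. -/

theorem proposition6 (α β γ δ σ M : ℝ) (ε : ℂ)
    (hlink : IsLinkage α β γ δ) (hell : IsElliptic α β γ δ)
    (hσ : σ = semiperimeter α β γ δ) (hM : M = linkageM α β γ δ)
    (hε : ε = if σ < α + β then 1 else -1) :
    (0 < M ∧ M ≠ 1 ∧ α + γ ≠ σ ∧ α + β ≠ σ) ∧
    -- `M > 1`: functions `cn`
    (1 < M → ∀ k : ℝ, k = Real.sqrt (1 - 1 / M) →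
      -- opposite angles
      (∀ t : ℂ, t ∈ regularSet k (quarterPeriod k) →
        ((k ^ 2 / (1 - k ^ 2) : ℝ) : ℂ) * cn k t ^ 2 * cn k (t + quarterPeriod k) ^ 2
          + cn k t ^ 2 + cn k (t + quarterPeriod k) ^ 2 - 1 = 0) ∧
      ParametrizedBy (OppositeEq α β γ δ) (regularSet k (quarterPeriod k))
        (fun t => px α β γ δ * cn k t) (fun t => pz α β γ δ * cn k (t + quarterPeriod k)) ∧
      ParametrizedBy (fun x z => g α β γ δ x z = 0) (regularSet k (quarterPeriod k))
        (fun t => px α β γ δ * cn k t) (fun t => pz α β γ δ * cn k (t + quarterPeriod k)) ∧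
      -- adjacent angles: the polynomial identity
      (∀ t θ : ℂ, Regular k t → Regular k θ → Regular k (t - θ) → dn k θ ≠ 0 →
        k ^ 2 * sn k θ ^ 2 / dn k θ ^ 2 * cn k t ^ 2 * cn k (t - θ) ^ 2 + cn k t ^ 2
          - 2 * cn k θ / dn k θ ^ 2 * cn k t * cn k (t - θ) + cn k (t - θ) ^ 2
          + (k ^ 2 - 1) * sn k θ ^ 2 / dn k θ ^ 2 = 0) ∧
      -- the angles `x`, `y` when `α + γ < σ`; the phase shift is `θ₁ = i τ`, `0 < τ < K'`
      (α + γ < σ →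
        (∃! τ : ℝ, τ ∈ Ioo 0 (quarterPeriod (coModulus k)) ∧
          dn k (τ * Complex.I) = Real.sqrt ((σ - α) * (σ - γ) / (α * γ))) ∧
        ∀ τ ∈ Ioo 0 (quarterPeriod (coModulus k)), ∀ θ : ℂ, θ = τ * Complex.I →
          ((k ^ 2 * sn k θ ^ 2 / dn k θ ^ 2 = ((α * γ / ((σ - α) * (σ - γ)) - 1 : ℝ) : ℂ) ∧
            cn k θ / dn k θ ^ 2
              = α * γ / csqrt ((σ - α) * (σ - γ) * ((σ - α) * (σ - γ) - β * δ)) ∧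
            (k ^ 2 - 1) * sn k θ ^ 2 / dn k θ ^ 2
              = (((σ - β) * (σ - δ) / ((σ - α) * (σ - γ) - β * δ) : ℝ) : ℂ)) ↔
            dn k θ = Real.sqrt ((σ - α) * (σ - γ) / (α * γ))) ∧
          (dn k θ = Real.sqrt ((σ - α) * (σ - γ) / (α * γ)) →
            ParametrizedBy (AdjacentEq α β γ δ) (regularSet k (-θ))
              (fun t => px α β γ δ * cn k t) (fun t => py α β γ δ * cn k (t - θ)) ∧
            ParametrizedBy (fun x y => f α β γ δ x y = 0) (regularSet k (-θ))
              (fun t => px α β γ δ * cn k t) (fun t => ε * py α β γ δ * cn k (t - θ)))) ∧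
      -- the angles `w`, `x` when `α + γ > σ`
      (σ < α + γ →
        (∃! τ : ℝ, τ ∈ Ioo 0 (quarterPeriod (coModulus k)) ∧
          dn k (τ * Complex.I) = Real.sqrt ((σ - β) * (σ - δ) / (β * δ))) ∧
        ∀ τ ∈ Ioo 0 (quarterPeriod (coModulus k)), ∀ θ : ℂ, θ = τ * Complex.I →
          ((k ^ 2 * sn k θ ^ 2 / dn k θ ^ 2 = ((β * δ / ((σ - β) * (σ - δ)) - 1 : ℝ) : ℂ) ∧
            cn k θ / dn k θ ^ 2
              = β * δ / csqrt ((σ - β) * (σ - δ) * ((σ - β) * (σ - δ) - α * γ)) ∧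
            (k ^ 2 - 1) * sn k θ ^ 2 / dn k θ ^ 2
              = (((σ - α) * (σ - γ) / ((σ - β) * (σ - δ) - α * γ) : ℝ) : ℂ)) ↔
            dn k θ = Real.sqrt ((σ - β) * (σ - δ) / (β * δ))) ∧
          (dn k θ = Real.sqrt ((σ - β) * (σ - δ) / (β * δ)) →
            ParametrizedBy (fun w x => AdjacentEq₂ α β γ δ x w) (regularSet k (-θ))
              (fun t => pw α β γ δ * cn k t) (fun t => px α β γ δ * cn k (t - θ)) ∧
            ParametrizedBy (fun w x => f β α δ γ x w = 0) (regularSet k (-θ))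
              (fun t => pw α β γ δ * cn k t) (fun t => ε * px α β γ δ * cn k (t - θ))))) ∧
    -- `M < 1`: functions `sn`
    (M < 1 → ∀ k : ℝ, k = Real.sqrt (1 - M) →
      -- opposite angles
      (∀ t : ℂ, t ∈ regularSet k (quarterPeriod k) →
        -(k : ℂ) ^ 2 * sn k t ^ 2 * sn k (t + quarterPeriod k) ^ 2
          + sn k t ^ 2 + sn k (t + quarterPeriod k) ^ 2 - 1 = 0) ∧
      ParametrizedBy (OppositeEq α β γ δ) (regularSet k (quarterPeriod k))
        (fun t => px α β γ δ * sn k t) (fun t => pz α β γ δ * sn k (t + quarterPeriod k)) ∧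
      ParametrizedBy (fun x z => g α β γ δ x z = 0) (regularSet k (quarterPeriod k))
        (fun t => px α β γ δ * sn k t) (fun t => pz α β γ δ * sn k (t + quarterPeriod k)) ∧
      -- adjacent angles: the polynomial identity
      (∀ t θ : ℂ, Regular k t → Regular k θ → Regular k (t - θ) →
        -(k : ℂ) ^ 2 * sn k θ ^ 2 * sn k t ^ 2 * sn k (t - θ) ^ 2 + sn k t ^ 2
          - 2 * cn k θ * dn k θ * sn k t * sn k (t - θ) + sn k (t - θ) ^ 2
          - sn k θ ^ 2 = 0) ∧
      -- the angles `x`, `y` when `α + γ > σ`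
      (σ < α + γ →
        (∃! τ : ℝ, τ ∈ Ioo 0 (quarterPeriod (coModulus k)) ∧
          dn k (τ * Complex.I) = Real.sqrt (α * γ / ((σ - α) * (σ - γ)))) ∧
        ∀ τ ∈ Ioo 0 (quarterPeriod (coModulus k)), ∀ θ : ℂ, θ = τ * Complex.I →
          ((-(k : ℂ) ^ 2 * sn k θ ^ 2 = ((α * γ / ((σ - α) * (σ - γ)) - 1 : ℝ) : ℂ) ∧
            cn k θ * dn k θ
              = α * γ / csqrt ((σ - α) * (σ - γ) * ((σ - α) * (σ - γ) - β * δ)) ∧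
            -sn k θ ^ 2
              = (((σ - β) * (σ - δ) / ((σ - α) * (σ - γ) - β * δ) : ℝ) : ℂ)) ↔
            dn k θ = Real.sqrt (α * γ / ((σ - α) * (σ - γ)))) ∧
          (dn k θ = Real.sqrt (α * γ / ((σ - α) * (σ - γ))) →
            ParametrizedBy (AdjacentEq α β γ δ) (regularSet k (-θ))
              (fun t => px α β γ δ * sn k t) (fun t => py α β γ δ * sn k (t - θ)) ∧
            ParametrizedBy (fun x y => f α β γ δ x y = 0) (regularSet k (-θ))
              (fun t => px α β γ δ * sn k t) (fun t => ε * py α β γ δ * sn k (t - θ)))) ∧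
      -- the angles `w`, `x` when `α + γ < σ`
      (α + γ < σ →
        (∃! τ : ℝ, τ ∈ Ioo 0 (quarterPeriod (coModulus k)) ∧
          dn k (τ * Complex.I) = Real.sqrt (β * δ / ((σ - β) * (σ - δ)))) ∧
        ∀ τ ∈ Ioo 0 (quarterPeriod (coModulus k)), ∀ θ : ℂ, θ = τ * Complex.I →
          ((-(k : ℂ) ^ 2 * sn k θ ^ 2 = ((β * δ / ((σ - β) * (σ - δ)) - 1 : ℝ) : ℂ) ∧
            cn k θ * dn k θ
              = β * δ / csqrt ((σ - β) * (σ - δ) * ((σ - β) * (σ - δ) - α * γ)) ∧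
            -sn k θ ^ 2
              = (((σ - α) * (σ - γ) / ((σ - β) * (σ - δ) - α * γ) : ℝ) : ℂ)) ↔
            dn k θ = Real.sqrt (β * δ / ((σ - β) * (σ - δ)))) ∧
          (dn k θ = Real.sqrt (β * δ / ((σ - β) * (σ - δ))) →
            ParametrizedBy (fun w x => AdjacentEq₂ α β γ δ x w) (regularSet k (-θ))
              (fun t => pw α β γ δ * sn k t) (fun t => px α β γ δ * sn k (t - θ)) ∧
            ParametrizedBy (fun w x => f β α δ γ x w = 0) (regularSet k (-θ))
              (fun t => pw α β γ δ * sn k t) (fun t => ε * px α β γ δ * sn k (t - θ))))) := by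
  subst hM
  have h : Lengths σ α β γ δ := hσ ▸ hlink.lengths
  obtain ⟨hf22, hf20, hf02⟩ := hell
  simp only [f22, f20, f02, h.semiperimeter_eq] at hf22 hf20 hf02
  -- Two lengths add up to `σ` exactly when the other two do, so the nonzero factors `σ - β - δ`, `σ
  -- - α - δ`, `σ - γ - δ` exclude all three degenerate pairings.
  have hαγ : α + γ ≠ σ := fun h0 => right_ne_zero_of_mul hf22 (by linarith [h.sum_eq])
  have hβγ : β + γ ≠ σ := fun h0 => right_ne_zero_of_mul hf20 (by linarith [h.sum_eq])
  have hαβ : α + β ≠ σ := fun h0 => right_ne_zero_of_mul hf02 (by linarith [h.sum_eq])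
  have hM0 := h.linkageM_pos
  have hM1 : linkageM α β γ δ ≠ 1 := by
    have hne : linkageM α β γ δ - 1 ≠ 0 := by
      rw [h.linkageM_sub_one]
      refine div_ne_zero (mul_ne_zero (mul_ne_zero h.pos.ne' ?_) (mul_ne_zero ?_ ?_))
        (mul_ne_zero (mul_ne_zero (mul_ne_zero h.sub_α.ne' h.sub_β.ne') h.sub_γ.ne') h.sub_δ.ne')
      · exact fun h0 => hαγ (by linarith)
      · exact fun h0 => hαβ (by linarith)
      · exact fun h0 => hβγ (by linarith)
    exact fun h0 => hne (by linarith)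
  have hx : px α β γ δ ≠ 0 := by
    rw [h.px_eq]
    exact amplitude_ne_zero h.pos.ne' h.sub_α.ne' h.sub_β.ne' (sub_ne_zero.2 hαβ)
  have hz : pz α β γ δ ≠ 0 := by
    rw [h.pz_eq]
    exact amplitude_ne_zero h.pos.ne' h.sub_γ.ne' h.sub_δ.ne'
      fun h0 => hαβ (by linarith [h.sum_eq])
  refine ⟨⟨hM0, hM1, hαγ, hαβ⟩, fun hM k hk => ?_, fun hM k hk => ?_⟩
  · obtain ⟨hk01, -⟩ := sqrt_one_sub_one_div_mem_Ioo hM hk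
    have hN := parametrizedBy_opposite_cn hM hk
    refine ⟨fun t ht => ?_, hN.of_iff hx hz (oppositeEq_iff hx hz),
      hN.of_iff hx hz (h.g_eq_zero_iff hαβ), fun t θ ht hθ htθ hd =>
      cn_biquadratic_div hk01 ht hθ htθ hd, fun hlt => h.adjacent_cn hM hk hlt hε,
      fun hlt => h.adjacent₂_cn hM hk hlt hε⟩
    have hk' : (1 - (k : ℂ) ^ 2) ≠ 0 := by
      exact_mod_cast (sub_pos.2 (show k ^ 2 < 1 by nlinarith [hk01.1, hk01.2])).ne'
    push_cast
    field_simp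
    linear_combination cn_opposite hk01 ht
  · obtain ⟨hk01, -⟩ := sqrt_one_sub_mem_Ioo hM0 hM hk
    have hN := parametrizedBy_opposite_sn hM0 hM hk
    refine ⟨fun t ht => ?_, hN.of_iff hx hz (oppositeEq_iff hx hz),
      hN.of_iff hx hz (h.g_eq_zero_iff hαβ), fun t θ ht hθ htθ => ?_,
      fun hlt => h.adjacent_sn hM hk hlt hε, fun hlt => h.adjacent₂_sn hM hk hlt hε⟩
    · linear_combination sn_opposite hk01 ht
    · linear_combination sn_biquadratic_sub hk01 ht hθ htθ
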